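/- Let $\mathbb{R}^{3,1}$ be Minkowski space, i.e. $\mathbb{R}^3\times\mathbb{R}\ni(x,t)$ with the metric $dx_1^2+dx_2^2+dx_3^2-dt^2$. Let $\Sigma\subset\mathbb{R}^{3,1}$ be an entire spacelike hypersurface, that is, the graph of a smooth function $u:\mathbb{R}^3\to\mathbb{R}$ with $|Du|<1$ everywhere, and suppose that the scalar curvature of the induced Riemannian metric on $\Sigma$ is bounded above by a negative constant. Let $\mathcal{D}(\Sigma)$ be the domain of dependence of $\Sigma$: the set of points $p\in\mathbb{R}^{3,1}$ such that every inextensible causal curve through $p$ meets $\Sigma$, where an inextensible causal curve is a set $\{(f(s),s)\mid s\in\mathbb{R}\}$ with $f:\mathbb{R}\to\mathbb{R}^3$ smooth and $|f'|\le 1$. For a lower semicontinuous function $\varphi:\mathbb{S}^2\to\mathbb{R}\cup\{+\infty\}$, put $F_\varphi=\{y\in\mathbb{S}^2\mid\varphi(y)<+\infty\}$ and $$\mathcal{D}_\varphi=\Big\{(x,t)\in\mathbb{R}^{3,1}\;\Big|\; t>\sup_{y\in F_\varphi}\big(\langle x,y\rangle-\varphi(y)\big)\Big\}.$$ Then, up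 to a time-reversing isometry (that is, after possibly replacing $\Sigma$ by its image under $(x,t)\mapsto(x,-t)$), there is a lower semicontinuous function $\varphi:\mathbb{S}^2\to\mathbb{R}\cup\{+\infty\}$ with $\operatorname{card}(F_\varphi)\ge 3$ such that $\mathcal{D}(\Sigma)=\mathcal{D}_\varphi$. In particular, $\mathcal{D}(\Sigma)$ is not a wedge: neither $\mathcal{D}(\Sigma)$ nor its image under $(x,t)\mapsto(x,-t)$ is of the form $\{(x,t)\mid t>\langle x,y_1\rangle-c_1\text{ and }t>\langle x,y_2\rangle-c_2\}$ with $y_1\ne y_2$ in $\mathbb{S}^2$ and $c_1,c_2\in\mathbb{R}$. -/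

import Mathlib

open scoped ContDiff

noncomputable section

namespace Minkowski

/-- Minkowski space `ℝ^{n,1}`: a point is `(x, t)` with `x ∈ ℝⁿ` and `t = x_{n+1} ∈ ℝ`. -/
abbrev Space (n : ℕ) : Type := EuclideanSpace ℝ (Fin n) × ℝ

/-- The Lorentzian bilinear form `dx₁² + ⋯ + dxₙ² - dx_{n+1}²`. -/
def form {n : ℕ} (v w : Space n) : ℝ := inner ℝ v.1 w.1 - v.2 * w.2

/-- The reflection `(x, t) ↦ (x, -t)`, a time-reversing isometry. -/
def timeReversal {n : ℕ} (p : Space n) : Space n := (p.1, -p.2)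

/-! ### Entire spacelike hypersurfaces -/

/-- A smooth function `u : ℝⁿ → ℝ` with `|Du| < 1` everywhere. The entire spacelike hypersurfaces
are exactly the graphs of such functions. -/
structure IsSpacelikeFunction {n : ℕ} (u : EuclideanSpace ℝ (Fin n) → ℝ) : Prop where
  smooth : ContDiff ℝ ∞ u
  norm_fderiv_lt_one : ∀ x, ‖fderiv ℝ u x‖ < 1

/-- The global parametrization `x ↦ (x, u x)` of the graph of `u`. -/
def graphMap {n : ℕ} (u : EuclideanSpace ℝ (Fin n) → ℝ) (x : EuclideanSpace ℝ (Fin n)) : Space n :=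
  (x, u x)

/-- The graph of `u`, as a subset of Minkowski space. -/
def graph {n : ℕ} (u : EuclideanSpace ℝ (Fin n) → ℝ) : Set (Space n) := Set.range (graphMap u)

/-! ### Scalar curvature of a metric given in global coordinates on `ℝⁿ` -/

/-- The partial derivative `∂ᵢ f`. -/
def partialDeriv {n : ℕ} (i : Fin n) (f : EuclideanSpace ℝ (Fin n) → ℝ)
    (x : EuclideanSpace ℝ (Fin n)) : ℝ :=
  fderiv ℝ f x (EuclideanSpace.single i 1)

/-- The Christoffel symbol `Γᵏᵢⱼ = ½ ∑ₗ gᵏˡ (∂ᵢ gⱼₗ + ∂ⱼ gᵢₗ - ∂ₗ gᵢⱼ)`. -/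
def christoffel {n : ℕ} (g : EuclideanSpace ℝ (Fin n) → Matrix (Fin n) (Fin n) ℝ)
    (k i j : Fin n) (x : EuclideanSpace ℝ (Fin n)) : ℝ :=
  (1 / 2 : ℝ) * ∑ l, (g x)⁻¹ k l *
    (partialDeriv i (fun y => g y j l) x + partialDeriv j (fun y => g y i l) x
      - partialDeriv l (fun y => g y i j) x)

/-- The component `Rˡₖᵢⱼ = ∂ᵢ Γˡⱼₖ - ∂ⱼ Γˡᵢₖ + ∑ₘ (Γˡᵢₘ Γᵐⱼₖ - Γˡⱼₘ Γᵐᵢₖ)` of the Riemann tensor,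
that is, the `l`-th component of `R(∂ᵢ, ∂ⱼ)∂ₖ`. -/
def riemann {n : ℕ} (g : EuclideanSpace ℝ (Fin n) → Matrix (Fin n) (Fin n) ℝ)
    (l k i j : Fin n) (x : EuclideanSpace ℝ (Fin n)) : ℝ :=
  partialDeriv i (christoffel g l j k) x - partialDeriv j (christoffel g l i k) x
    + ∑ m, (christoffel g l i m x * christoffel g m j k x
      - christoffel g l j m x * christoffel g m i k x)

/-- The Ricci tensor `Ricⱼₖ = ∑ᵢ Rⁱₖᵢⱼ`. -/
def ricci {n : ℕ} (g : EuclideanSpace ℝ (Fin n) → Matrix (Fin n) (Fin n) ℝ)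
    (j k : Fin n) (x : EuclideanSpace ℝ (Fin n)) : ℝ :=
  ∑ i, riemann g i k i j x

/-- The scalar curvature `∑ⱼₖ gʲᵏ Ricⱼₖ`. -/
def scalarCurvature {n : ℕ} (g : EuclideanSpace ℝ (Fin n) → Matrix (Fin n) (Fin n) ℝ)
    (x : EuclideanSpace ℝ (Fin n)) : ℝ :=
  ∑ j, ∑ k, (g x)⁻¹ j k * ricci g j k x

/-- The first fundamental form of the graph of `u` in the coordinates `x`: the pull-back of the
Lorentzian form by `x ↦ (x, u x)`. -/
def firstFundamentalForm {n : ℕ} (u : EuclideanSpace ℝ (Fin n) → ℝ)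
    (x : EuclideanSpace ℝ (Fin n)) : Matrix (Fin n) (Fin n) ℝ :=
  Matrix.of fun i j => form (fderiv ℝ (graphMap u) x (EuclideanSpace.single i 1))
    (fderiv ℝ (graphMap u) x (EuclideanSpace.single j 1))

/-- The (intrinsic) scalar curvature of the graph of `u` at the point `(x, u x)`. -/
def graphScalarCurvature {n : ℕ} (u : EuclideanSpace ℝ (Fin n) → ℝ)
    (x : EuclideanSpace ℝ (Fin n)) : ℝ :=
  scalarCurvature (firstFundamentalForm u) x

/-! ### Domains of dependence, regular domains, wedges -/

/-- The domain of dependence of `S`: the set of points `p` such that every inextensible causal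
curve through `p` meets `S`. Such a curve is `{(f t, t) | t ∈ ℝ}` with `f : ℝ → ℝⁿ` smooth and
`|f'| ≤ 1`. -/
def domainOfDependence {n : ℕ} (S : Set (Space n)) : Set (Space n) :=
  {p | ∀ f : ℝ → EuclideanSpace ℝ (Fin n), ContDiff ℝ ∞ f → (∀ t, ‖deriv f t‖ ≤ 1) →
    f p.2 = p.1 → ∃ t, (f t, t) ∈ S}

/-- The unit sphere `𝕊^{n-1}` of `ℝⁿ`. -/
abbrev UnitSphere (n : ℕ) : Type := Metric.sphere (0 : EuclideanSpace ℝ (Fin n)) 1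

/-- `F_φ = {y | φ y < +∞}` for `φ : 𝕊^{n-1} → ℝ ∪ {+∞}`. -/
def finiteSet {n : ℕ} (φ : UnitSphere n → WithTop ℝ) : Set (UnitSphere n) := {y | φ y < ⊤}

/-- `V_φ(x) = sup_{y ∈ F_φ} (⟨x, y⟩ - φ y)`, the supremum being taken in the extended reals
(`untopD 0` only reads off the real number `φ y` for `y ∈ F_φ`). -/
def supportFunction {n : ℕ} (φ : UnitSphere n → WithTop ℝ) (x : EuclideanSpace ℝ (Fin n)) : EReal :=
  ⨆ y ∈ finiteSet φ,
    ((inner ℝ x (y : EuclideanSpace ℝ (Fin n)) - (φ y).untopD 0 : ℝ) : EReal)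

/-- `𝒟_φ`, the open supergraph of `V_φ`. -/
def regularDomain {n : ℕ} (φ : UnitSphere n → WithTop ℝ) : Set (Space n) :=
  {p | supportFunction φ p.1 < (p.2 : EReal)}

/-- The open future half-space bounded by the lightlike hyperplane `t = ⟨x, y⟩ - c`. -/
def futureHalfSpace {n : ℕ} (y : UnitSphere n) (c : ℝ) : Set (Space n) :=
  {p | inner ℝ p.1 (y : EuclideanSpace ℝ (Fin n)) - c < p.2}

/-- A future wedge: the intersection of two future half-spaces bounded by non-parallel lightlike
hyperplanes. -/
def IsFutureWedge {n : ℕ} (D : Set (Space n)) : Prop :=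
  ∃ (y₁ y₂ : UnitSphere n) (c₁ c₂ : ℝ), y₁ ≠ y₂ ∧ D = futureHalfSpace y₁ c₁ ∩ futureHalfSpace y₂ c₂

/-- A wedge, future or past; the past wedges are the time-reversals of the future ones. -/
def IsWedge {n : ℕ} (D : Set (Space n)) : Prop :=
  IsFutureWedge D ∨ IsFutureWedge (timeReversal '' D)

end Minkowski

end

noncomputable section

namespace Minkowski

open Matrix

variable {n : ℕ}

/-! ### Partial derivatives -/

/-! By the Gauss equation (`graphScalarCurvature_eq`) the curvature bound says that `sigma`, twice
the second symmetric function of the eigenvalues of `S h`, is at least `c (1 - |Du|²)`. Hence the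
mean curvature never vanishes, and after a time reversal it is positive (`IsAdmissible`).

The barriers are level sets of `Φ_ε = (1 - ε) α β / κ + ε (τ² - |ξ|²)`, which interpolates between
hyperboloids (`ε = 1`) and the flat products hyperbola × plane (`ε = 0`). At a local maximum of
`Φ_ε` on the graph with `α, β, Φ_ε > 0`, monotonicity of `sigma` gives `c Φ_ε ≤ 6 ε`
(`squashedForm_le_of_isLocalMax`).

A point whose causal future meets the graph in an unbounded set lies on a lightlike hyperplane below
the graph (`exists_support_of_not_isBounded`); otherwise the hyperboloid estimate applies. Applied
along a lightlike line, this dichotomy yields at least two supporting null directions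
(`exists_liesAbove_ne`). If there were exactly two, hyperboloids would bound the product of the
heights over the two extremal hyperplanes, which makes the comparison with `Φ_ε` legitimate for
every `ε > 0`; letting `ε → 0` is absurd (`exists_liesAbove_ne_ne`).

Finally `𝒟(Σ)` consists of the points above all lightlike hyperplanes lying below the graph
(`mem_domainOfDependence_iff`), which is `𝒟_φ` for `φ y = sup_z (⟨z, y⟩ - u z)`. -/

theorem partialDeriv_sub {f g : EuclideanSpace ℝ (Fin n) → ℝ} {x} (i : Fin n)
    (hf : DifferentiableAt ℝ f x) (hg : DifferentiableAt ℝ g x) :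
    partialDeriv i (fun y => f y - g y) x = partialDeriv i f x - partialDeriv i g x := by
  simp [partialDeriv, fderiv_fun_sub hf hg]

theorem partialDeriv_neg {f : EuclideanSpace ℝ (Fin n) → ℝ} {x} (i : Fin n) :
    partialDeriv i (fun y => - f y) x = - partialDeriv i f x := by
  simp [partialDeriv, fderiv_fun_neg]

theorem partialDeriv_const {x : EuclideanSpace ℝ (Fin n)} (i : Fin n) (c : ℝ) :
    partialDeriv i (fun _ => c) x = 0 := by
  simp [partialDeriv]

theorem partialDeriv_mul {f g : EuclideanSpace ℝ (Fin n) → ℝ} {x} (i : Fin n)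
    (hf : DifferentiableAt ℝ f x) (hg : DifferentiableAt ℝ g x) :
    partialDeriv i (fun y => f y * g y) x
      = partialDeriv i f x * g x + f x * partialDeriv i g x := by
  simp [partialDeriv, fderiv_fun_mul hf hg]; ring

theorem partialDeriv_inv {f : EuclideanSpace ℝ (Fin n) → ℝ} {x} (i : Fin n)
    (hf : DifferentiableAt ℝ f x) (h0 : f x ≠ 0) :
    partialDeriv i (fun y => (f y)⁻¹) x = - partialDeriv i f x / (f x) ^ 2 := by
  have h := (hasDerivAt_inv h0).comp_hasFDerivAt x hf.hasFDerivAt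
  have h2 : (fun y => (f y)⁻¹) = Inv.inv ∘ f := rfl
  simp only [partialDeriv]
  rw [h2, h.fderiv]
  simp
  field_simp

theorem partialDeriv_sum {ι : Type*} (s : Finset ι) {f : ι → EuclideanSpace ℝ (Fin n) → ℝ} {x}
    (i : Fin n) (hf : ∀ m ∈ s, DifferentiableAt ℝ (f m) x) :
    partialDeriv i (fun y => ∑ m ∈ s, f m y) x = ∑ m ∈ s, partialDeriv i (f m) x := by
  simp [partialDeriv, fderiv_fun_sum hf]

theorem contDiff_partialDeriv {f : EuclideanSpace ℝ (Fin n) → ℝ} (hf : ContDiff ℝ ∞ f)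
    (i : Fin n) : ContDiff ℝ ∞ (partialDeriv i f) := by
  unfold partialDeriv
  exact (hf.fderiv_right (m := ∞) (by simp)).clm_apply contDiff_const

theorem partialDeriv_partialDeriv {f : EuclideanSpace ℝ (Fin n) → ℝ} (hf : ContDiff ℝ ∞ f)
    (i j : Fin n) (x) :
    partialDeriv i (partialDeriv j f) x
      = fderiv ℝ (fderiv ℝ f) x (EuclideanSpace.single i 1) (EuclideanSpace.single j 1) := by
  have hd : DifferentiableAt ℝ (fderiv ℝ f) x :=
    ((hf.fderiv_right (m := ∞) (by simp)).differentiable (by simp)) x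
  have : partialDeriv j f = fun y => fderiv ℝ f y (EuclideanSpace.single j 1) := rfl
  rw [this]
  simp only [partialDeriv]
  rw [fderiv_clm_apply hd (by fun_prop)]
  simp

theorem partialDeriv_comm {f : EuclideanSpace ℝ (Fin n) → ℝ} (hf : ContDiff ℝ ∞ f)
    (i j : Fin n) (x) :
    partialDeriv i (partialDeriv j f) x = partialDeriv j (partialDeriv i f) x := by
  rw [partialDeriv_partialDeriv hf, partialDeriv_partialDeriv hf]
  exact (hf.contDiffAt.isSymmSndFDerivAt (by
    simpa using WithTop.coe_le_coe.2 (le_top : (2 : ℕ∞) ≤ ⊤))) _ _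

/-! ### First and second derivatives of the height function -/

/-- The gradient of `u` in coordinates. -/
def grad (u : EuclideanSpace ℝ (Fin n) → ℝ) (x : EuclideanSpace ℝ (Fin n)) : Fin n → ℝ :=
  fun i => partialDeriv i u x

/-- The Hessian matrix of `u`. -/
def hess (u : EuclideanSpace ℝ (Fin n) → ℝ) (x : EuclideanSpace ℝ (Fin n)) :
    Matrix (Fin n) (Fin n) ℝ :=
  Matrix.of fun i j => partialDeriv i (partialDeriv j u) x

/-- The inverse of `1 - p pᵀ`. -/
def metricInv (p : Fin n → ℝ) : Matrix (Fin n) (Fin n) ℝ :=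
  1 + (1 - p ⬝ᵥ p)⁻¹ • vecMulVec p p

/-- For a symmetric bilinear form `h`, the number `(tr_S h)² - |h|²_S`, which is twice the second
elementary symmetric function of the eigenvalues of `S h`. -/
def sigma (S h : Matrix (Fin n) (Fin n) ℝ) : ℝ :=
  (S * h).trace ^ 2 - (S * h * (S * h)).trace

theorem hess_isSymm {u : EuclideanSpace ℝ (Fin n) → ℝ} (hu : ContDiff ℝ ∞ u) (x) :
    (hess u x).IsSymm := by
  ext i j
  simp [hess, partialDeriv_comm hu j i]

theorem grad_dotProduct_lt_one {u : EuclideanSpace ℝ (Fin n) → ℝ} (hu : IsSpacelikeFunction u)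
    (x) : grad u x ⬝ᵥ grad u x < 1 := by
  set p := grad u x with hp
  set v : EuclideanSpace ℝ (Fin n) := WithLp.toLp 2 p with hv
  have h1 : fderiv ℝ u x v = p ⬝ᵥ p := by
    have : v = ∑ i, p i • EuclideanSpace.single i (1 : ℝ) := by
      ext j
      simp [hv, Finset.sum_apply, Pi.single_apply]
    rw [this, map_sum]
    simp [dotProduct, hp, grad, partialDeriv]
  have h2 : ‖v‖ ^ 2 = p ⬝ᵥ p := by
    rw [EuclideanSpace.norm_sq_eq]
    simp [hv, dotProduct, sq]
  have h3 : fderiv ℝ u x v ≤ ‖fderiv ℝ u x‖ * ‖v‖ :=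
    (le_abs_self _).trans ((fderiv ℝ u x).le_opNorm v)
  have h4 := hu.norm_fderiv_lt_one x
  have h5 := norm_nonneg (fderiv ℝ u x)
  have h6 := norm_nonneg v
  rw [h1, ← h2] at h3
  rw [← h2]
  by_contra! h7
  have h8 : 1 ≤ ‖v‖ := by nlinarith
  nlinarith

theorem firstFundamentalForm_eq {u : EuclideanSpace ℝ (Fin n) → ℝ} (hu : ContDiff ℝ ∞ u) (x) :
    firstFundamentalForm u x = 1 - vecMulVec (grad u x) (grad u x) := by
  have hd : DifferentiableAt ℝ u x := (hu.differentiable (by simp)) x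
  have h : fderiv ℝ (graphMap u) x
      = (ContinuousLinearMap.id ℝ _).prod (fderiv ℝ u x) := by
    have := (hasFDerivAt_id (𝕜 := ℝ) x).prodMk hd.hasFDerivAt
    exact this.fderiv
  ext i j
  simp [firstFundamentalForm, h, form, vecMulVec_apply, grad, partialDeriv, Matrix.one_apply,
    EuclideanSpace.inner_single_left, PiLp.single_apply]

theorem one_sub_mul_metricInv {p : Fin n → ℝ} (hp : p ⬝ᵥ p < 1) :
    (1 - vecMulVec p p) * metricInv p = 1 := by
  have hD : (1 - p ⬝ᵥ p) ≠ 0 := by linarith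
  have hpp : vecMulVec p p * vecMulVec p p = (p ⬝ᵥ p) • vecMulVec p p := by
    rw [vecMulVec_mul_vecMulVec]
    ext i j
    simp [vecMulVec_apply]
    ring
  simp only [metricInv, sub_mul, mul_add, one_mul, mul_one, mul_smul_comm, hpp]
  ext i j
  simp only [Matrix.sub_apply, Matrix.add_apply, Matrix.smul_apply, smul_eq_mul]
  field_simp
  ring

theorem inv_firstFundamentalForm {u : EuclideanSpace ℝ (Fin n) → ℝ} (hu : IsSpacelikeFunction u)
    (x) : (firstFundamentalForm u x)⁻¹ = metricInv (grad u x) := by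
  rw [firstFundamentalForm_eq hu.smooth]
  exact Matrix.inv_eq_right_inv (one_sub_mul_metricInv (grad_dotProduct_lt_one hu x))

theorem metricInv_mulVec_self {p : Fin n → ℝ} (hp : p ⬝ᵥ p < 1) :
    metricInv p *ᵥ p = (1 - p ⬝ᵥ p)⁻¹ • p := by
  have hD : (1 - p ⬝ᵥ p) ≠ 0 := by linarith
  ext i
  simp [metricInv, add_mulVec, smul_mulVec, vecMulVec_mulVec]
  field_simp
  ring

theorem partialDeriv_firstFundamentalForm {u : EuclideanSpace ℝ (Fin n) → ℝ}
    (hu : ContDiff ℝ ∞ u) (i j l : Fin n) (x) :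
    partialDeriv i (fun y => firstFundamentalForm u y j l) x
      = - (hess u x i j * grad u x l + grad u x j * hess u x i l) := by
  have hdiff : ∀ m, DifferentiableAt ℝ (partialDeriv m u) x := fun m =>
    ((contDiff_partialDeriv hu m).differentiable (by simp)) x
  have : (fun y => firstFundamentalForm u y j l)
      = fun y => (1 : Matrix (Fin n) (Fin n) ℝ) j l
          - partialDeriv j u y * partialDeriv l u y := by
    funext y
    rw [firstFundamentalForm_eq hu]
    simp [vecMulVec_apply, grad]
  rw [this, partialDeriv_sub _ (by fun_prop) ((hdiff j).fun_mul (hdiff l)), partialDeriv_const,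
    partialDeriv_mul _ (hdiff j) (hdiff l)]
  simp [hess, grad]

/-- The three derivatives of `g` combine to `-2 hᵢⱼ pₗ`, and `p` is an eigenvector of the inverse
metric. -/
theorem christoffel_eq {u : EuclideanSpace ℝ (Fin n) → ℝ} (hu : IsSpacelikeFunction u)
    (k i j : Fin n) (x) :
    christoffel (firstFundamentalForm u) k i j x
      = - ((grad u x k * (1 - grad u x ⬝ᵥ grad u x)⁻¹) * hess u x i j) := by
  have hs := hess_isSymm hu.smooth x
  have h1 := congrFun (metricInv_mulVec_self (grad_dotProduct_lt_one hu x)) k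
  simp only [mulVec, dotProduct, Pi.smul_apply, smul_eq_mul] at h1
  simp only [christoffel, inv_firstFundamentalForm hu, partialDeriv_firstFundamentalForm hu.smooth]
  have h2 : ∀ l, metricInv (grad u x) k l *
      (-(hess u x i j * grad u x l + grad u x j * hess u x i l) +
        -(hess u x j i * grad u x l + grad u x i * hess u x j l) -
        -(hess u x l i * grad u x j + grad u x i * hess u x l j))
      = (-2 * hess u x i j) * (metricInv (grad u x) k l * grad u x l) := by
    intro l
    rw [hs.apply i j, hs.apply i l, hs.apply j l]; ring
  simp only [h2, ← Finset.mul_sum, h1, dotProduct]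
  ring

/-- This is the Gauss equation, with second fundamental form `h / √(1 - |p|²)`. The third
derivatives of `u` cancel by symmetry (`h3`); the terms where `∂` falls on `pₗ / (1 - |p|²)`,
together with the quadratic Christoffel terms, leave `S h`. -/
theorem riemann_eq {u : EuclideanSpace ℝ (Fin n) → ℝ} (hu : IsSpacelikeFunction u)
    (l k i j : Fin n) (x) :
    riemann (firstFundamentalForm u) l k i j x
      = - (1 - grad u x ⬝ᵥ grad u x)⁻¹ *
        ((metricInv (grad u x) * hess u x) l i * hess u x j k
          - (metricInv (grad u x) * hess u x) l j * hess u x i k) := by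
  have hs := hess_isSymm hu.smooth x
  have hD : (1 - grad u x ⬝ᵥ grad u x) ≠ 0 := by
    have := grad_dotProduct_lt_one hu x; linarith
  have hdiff : ∀ m, DifferentiableAt ℝ (partialDeriv m u) x := fun m =>
    ((contDiff_partialDeriv hu.smooth m).differentiable (by simp)) x
  have hdiff2 : ∀ m m', DifferentiableAt ℝ (fun y => hess u y m m') x := fun m m' =>
    ((contDiff_partialDeriv (contDiff_partialDeriv hu.smooth m') m).differentiable (by simp)) x
  have hsum : DifferentiableAt ℝ
      (fun y => ∑ m, partialDeriv m u y * partialDeriv m u y) x :=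
    DifferentiableAt.fun_sum fun m _ => (hdiff m).fun_mul (hdiff m)
  have hsum' : DifferentiableAt ℝ (fun y => ∑ m, grad u y m * grad u y m) x := hsum
  have hDd : DifferentiableAt ℝ (fun y => 1 - grad u y ⬝ᵥ grad u y) x := by
    simp only [dotProduct, grad]
    exact (differentiableAt_const _).fun_sub hsum
  have hgrad : ∀ m, DifferentiableAt ℝ (fun y => grad u y m) x := hdiff
  have dgrad : ∀ a m, partialDeriv a (fun y => grad u y m) x = hess u x a m := fun a m => rfl
  have dD : ∀ a, partialDeriv a (fun y => 1 - grad u y ⬝ᵥ grad u y) x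
      = - (2 * ∑ m, grad u x m * hess u x a m) := by
    intro a
    simp only [dotProduct]
    rw [partialDeriv_sub (f := fun _ => 1) _ (differentiableAt_const _) hsum', partialDeriv_const,
      partialDeriv_sum (f := fun m y => grad u y m * grad u y m) _ _
        fun m _ => (hdiff m).fun_mul (hdiff m), Finset.mul_sum, zero_sub]
    congr 1
    refine Finset.sum_congr rfl fun m _ => ?_
    rw [partialDeriv_mul _ (hgrad m) (hgrad m), dgrad]; ring
  have dΓ : ∀ a b c, partialDeriv a (christoffel (firstFundamentalForm u) l b c) x
      = - ((hess u x a l * (1 - grad u x ⬝ᵥ grad u x)⁻¹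
          + grad u x l * ((2 * ∑ m, grad u x m * hess u x a m)
            / (1 - grad u x ⬝ᵥ grad u x) ^ 2)) * hess u x b c
        + (grad u x l * (1 - grad u x ⬝ᵥ grad u x)⁻¹)
          * partialDeriv a (fun y => hess u y b c) x) := by
    intro a b c
    have : christoffel (firstFundamentalForm u) l b c
        = fun y => - ((grad u y l * (1 - grad u y ⬝ᵥ grad u y)⁻¹) * hess u y b c) := by
      funext y; exact christoffel_eq hu l b c y
    rw [this, partialDeriv_neg, partialDeriv_mul _ ((hgrad l).fun_mul (hDd.fun_inv hD)) (hdiff2 b c),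
      partialDeriv_mul _ (hgrad l) (hDd.fun_inv hD), partialDeriv_inv _ hDd hD, dD, dgrad]
    ring
  have h3 : partialDeriv j (fun y => hess u y i k) x = partialDeriv i (fun y => hess u y j k) x :=
    partialDeriv_comm (contDiff_partialDeriv hu.smooth k) j i x
  have hMh : ∀ a, (metricInv (grad u x) * hess u x) l a
      = hess u x a l + (1 - grad u x ⬝ᵥ grad u x)⁻¹ * grad u x l
          * ∑ m, grad u x m * hess u x a m := by
    intro a
    simp only [metricInv, add_mul, one_mul, Matrix.add_apply, smul_mul_assoc,
      Matrix.smul_apply, smul_eq_mul]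
    rw [hs.apply, vecMulVec_mul, vecMulVec_apply, mul_assoc]
    simp only [vecMul, dotProduct, hs.apply]
  have hq : ∀ a b c, ∑ m, christoffel (firstFundamentalForm u) l a m x
        * christoffel (firstFundamentalForm u) m b c x
      = (1 - grad u x ⬝ᵥ grad u x)⁻¹ ^ 2 * grad u x l * hess u x b c
          * ∑ m, grad u x m * hess u x a m := by
    intro a b c
    simp only [christoffel_eq hu, Finset.mul_sum]
    refine Finset.sum_congr rfl fun m _ => ?_
    ring
  simp only [riemann, Finset.sum_sub_distrib, hq, dΓ, hMh, h3]
  field_simp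
  ring

/-- The Gauss equation for the scalar curvature of a spacelike graph. -/
theorem graphScalarCurvature_eq {u : EuclideanSpace ℝ (Fin n) → ℝ} (hu : IsSpacelikeFunction u)
    (x) :
    graphScalarCurvature u x
      = - (1 - grad u x ⬝ᵥ grad u x)⁻¹ * sigma (metricInv (grad u x)) (hess u x) := by
  have hs := hess_isSymm hu.smooth x
  set S := metricInv (grad u x) with hS
  set h := hess u x with hh
  set D := (1 - grad u x ⬝ᵥ grad u x)⁻¹ with hD
  have hric : ∀ j k, ricci (firstFundamentalForm u) j k x
      = - D * ((S * h).trace * h j k - (h * (S * h)) k j) := by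
    intro j k
    simp only [ricci, riemann_eq hu]
    rw [← Finset.mul_sum, Finset.sum_sub_distrib, ← Finset.sum_mul]
    congr 2
    rw [Matrix.mul_apply]
    refine Finset.sum_congr rfl fun i _ => ?_
    rw [hs.apply, mul_comm]
  simp only [graphScalarCurvature, scalarCurvature, inv_firstFundamentalForm hu, hric, sigma]
  have e1 : (S * h).trace = ∑ j, ∑ k, S j k * h j k := by
    simp only [trace, diag, Matrix.mul_apply]
    simp only [fun i j => hs.apply i j]
  have e2 : (S * h * (S * h)).trace = ∑ j, ∑ k, S j k * (h * (S * h)) k j := by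
    rw [Matrix.mul_assoc]
    simp only [trace, diag, Matrix.mul_apply (M := S)]
  have e3 : ∑ j, ∑ k, S j k * (-D * ((S * h).trace * h j k - (h * (S * h)) k j))
      = -D * ((S * h).trace * (∑ j, ∑ k, S j k * h j k)
        - ∑ j, ∑ k, S j k * (h * (S * h)) k j) := by
    simp only [Finset.mul_sum, ← Finset.sum_sub_distrib]
    refine Finset.sum_congr rfl fun j _ => Finset.sum_congr rfl fun k _ => ?_
    ring
  rw [e2, sq, e3, ← e1]

/-! ### Monotonicity of `sigma` -/

theorem sq_apply_le_of_posSemidef {P : Matrix (Fin n) (Fin n) ℝ} (hP : P.PosSemidef) (i j : Fin n) :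
    P i j ^ 2 ≤ P i i * P j j := by
  have hsym : P j i = P i j := by simpa using hP.1.apply i j
  have h : ∀ s : ℝ, 0 ≤ P i i * (s * s) + 2 * P i j * s + P j j := by
    intro s
    have := hP.dotProduct_mulVec_nonneg (Pi.single i s + Pi.single j 1)
    simp [mulVec_add, dotProduct_add, add_dotProduct, mulVec_single, hsym] at this
    linarith
  have := discrim_le_zero h
  simp only [discrim] at this
  linarith

theorem trace_mul_eq_sum {A B : Matrix (Fin n) (Fin n) ℝ} (hB : B.IsSymm) :
    (A * B).trace = ∑ q : Fin n × Fin n, A q.1 q.2 * B q.1 q.2 := by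
  rw [Fintype.sum_prod_type]
  simp only [trace, diag, Matrix.mul_apply]
  simp only [hB.apply]

theorem trace_mul_self_le_of_posSemidef {P : Matrix (Fin n) (Fin n) ℝ} (hP : P.PosSemidef) :
    (P * P).trace ≤ P.trace ^ 2 := by
  have hs : P.IsSymm := by simpa [IsHermitian, IsSymm] using hP.1
  rw [trace_mul_eq_sum hs, Fintype.sum_prod_type, sq, trace, Finset.sum_mul_sum]
  refine Finset.sum_le_sum fun i _ => Finset.sum_le_sum fun j _ => ?_
  rw [← sq]
  exact sq_apply_le_of_posSemidef hP i j

/-- With `B = h + P`, the increment is `2 (tr h tr P - tr (h P)) + ((tr P)² - tr P²)`. The second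
bracket is nonnegative since `P ≥ 0`; the first by Cauchy–Schwarz, because `sigma 1 h ≥ 0` means `tr
h² ≤ (tr h)²`. -/
theorem sigma_one_mono {h B : Matrix (Fin n) (Fin n) ℝ} (hh : h.IsSymm) (hB : (B - h).PosSemidef)
    (ht : 0 ≤ h.trace) (hσ : 0 ≤ sigma 1 h) : sigma 1 h ≤ sigma 1 B := by
  obtain ⟨P, rfl⟩ : ∃ P, B = h + P := ⟨B - h, by abel⟩
  rw [add_sub_cancel_left] at hB
  have hPs : P.IsSymm := by simpa [IsHermitian, IsSymm] using hB.1
  have h1 := trace_mul_self_le_of_posSemidef hB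
  have h2 : 0 ≤ P.trace := hB.trace_nonneg
  have h3 : (h * P).trace ≤ h.trace * P.trace := by
    refine le_of_sq_le_sq ?_ (by positivity)
    calc (h * P).trace ^ 2 ≤ (h * h).trace * (P * P).trace := by
          rw [trace_mul_eq_sum hPs, trace_mul_eq_sum hPs, trace_mul_eq_sum hh]
          simp only [← sq]
          exact Finset.sum_mul_sq_le_sq_mul_sq _ _ _
      _ ≤ h.trace ^ 2 * P.trace ^ 2 := by
          refine mul_le_mul ?_ h1 ?_ (by positivity)
          · simp only [sigma, one_mul] at hσ; linarith
          · rw [trace_mul_eq_sum hPs]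
            exact Finset.sum_nonneg fun q _ => mul_self_nonneg _
      _ = (h.trace * P.trace) ^ 2 := by ring
  have h4 : (P * h).trace = (h * P).trace := trace_mul_comm _ _
  simp only [sigma, one_mul, add_mul, mul_add, trace_add, h4]
  nlinarith

theorem sigma_conjTranspose_mul_self (R h : Matrix (Fin n) (Fin n) ℝ) :
    sigma (Rᴴ * R) h = sigma 1 (R * h * Rᴴ) := by
  have h1 : (Rᴴ * R * h).trace = (R * h * Rᴴ).trace := by
    rw [Matrix.mul_assoc, trace_mul_comm]
  have h2 : (Rᴴ * R * h * (Rᴴ * R * h)).trace = (R * h * Rᴴ * (R * h * Rᴴ)).trace := by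
    rw [show Rᴴ * R * h * (Rᴴ * R * h) = Rᴴ * (R * h * Rᴴ * (R * h)) by
      simp only [Matrix.mul_assoc], trace_mul_comm]
    simp only [Matrix.mul_assoc]
  simp only [sigma, one_mul, h1, h2]

theorem exists_eq_conjTranspose_mul_self {S : Matrix (Fin n) (Fin n) ℝ}
    (hS : S.PosSemidef) : ∃ R : Matrix (Fin n) (Fin n) ℝ, S = Rᴴ * R := by
  open scoped MatrixOrder Matrix.Norms.L2Operator in
  exact CStarAlgebra.nonneg_iff_eq_star_mul_self.mp hS.nonneg

theorem sigma_mono {S h B : Matrix (Fin n) (Fin n) ℝ} (hS : S.PosSemidef) (hh : h.IsSymm)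
    (hB : (B - h).PosSemidef) (ht : 0 ≤ (S * h).trace) (hσ : 0 ≤ sigma S h) :
    sigma S h ≤ sigma S B := by
  obtain ⟨R, rfl⟩ := exists_eq_conjTranspose_mul_self hS
  rw [sigma_conjTranspose_mul_self] at hσ ⊢
  rw [sigma_conjTranspose_mul_self]
  refine sigma_one_mono ?_ ?_ ?_ hσ
  · simp only [IsSymm, conjTranspose_eq_transpose_of_trivial, transpose_mul, transpose_transpose,
      hh.eq, Matrix.mul_assoc]
  · have := hB.mul_mul_conjTranspose_same R
    rwa [mul_sub, sub_mul] at this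
  · rwa [Matrix.mul_assoc, trace_mul_comm] at ht

theorem trace_mul_self_nonneg {S h : Matrix (Fin n) (Fin n) ℝ} (hS : S.PosSemidef)
    (hh : h.IsSymm) : 0 ≤ (S * h * (S * h)).trace := by
  obtain ⟨R, rfl⟩ := exists_eq_conjTranspose_mul_self hS
  have h2 : (Rᴴ * R * h * (Rᴴ * R * h)).trace = (R * h * Rᴴ * (R * h * Rᴴ)).trace := by
    rw [show Rᴴ * R * h * (Rᴴ * R * h) = Rᴴ * (R * h * Rᴴ * (R * h)) by
      simp only [Matrix.mul_assoc], trace_mul_comm]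
    simp only [Matrix.mul_assoc]
  have h3 : (R * h * Rᴴ).IsSymm := by
    simp only [IsSymm, conjTranspose_eq_transpose_of_trivial, transpose_mul, transpose_transpose,
      hh.eq, Matrix.mul_assoc]
  rw [h2, trace_mul_eq_sum h3]
  exact Finset.sum_nonneg fun q _ => mul_self_nonneg _

theorem sigma_smul (S h : Matrix (Fin n) (Fin n) ℝ) (c : ℝ) :
    sigma S (c • h) = c ^ 2 * sigma S h := by
  simp [sigma]; ring

theorem metricInv_posSemidef {p : Fin n → ℝ} (hp : p ⬝ᵥ p < 1) : (metricInv p).PosSemidef := by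
  refine PosSemidef.one.add (PosSemidef.smul ?_ (by rw [inv_nonneg]; linarith))
  simpa using posSemidef_vecMulVec_self_star p

/-! ### The Lorentzian splitting defined by two lightlike vectors -/

section Splitting

variable {E : Type*} [NormedAddCommGroup E] [InnerProductSpace ℝ E]

/-- Half the Lorentzian product of the lightlike vectors `(y₁, 1)` and `(y₂, 1)`, up to sign. -/
def nullGap (y₁ y₂ : E) : ℝ := (1 - inner ℝ y₁ y₂) / 2

theorem nullGap_pos {y₁ y₂ : E} (h₁ : ‖y₁‖ = 1) (h₂ : ‖y₂‖ = 1) (h : y₁ ≠ y₂) :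
    0 < nullGap y₁ y₂ := by
  have := inner_lt_one_iff_real_of_norm_eq_one h₁ h₂ |>.2 h
  unfold nullGap; linarith

theorem nullGap_le_one {y₁ y₂ : E} (h₁ : ‖y₁‖ = 1) (h₂ : ‖y₂‖ = 1) : nullGap y₁ y₂ ≤ 1 := by
  have := neg_le_of_abs_le (abs_real_inner_le_norm y₁ y₂)
  rw [h₁, h₂] at this
  unfold nullGap; linarith

/-- The spatial part of the component of `(ξ, τ)` orthogonal to `(y₁, 1)` and `(y₂, 1)`. -/
def transverse (y₁ y₂ ξ : E) (τ : ℝ) : E :=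
  ξ - (2 * nullGap y₁ y₂)⁻¹ • ((τ - inner ℝ ξ y₂) • y₁ + (τ - inner ℝ ξ y₁) • y₂)

/-- The component `(ζ, T)` of `(ξ, τ)` Lorentz-orthogonal to both null vectors satisfies `⟨ζ, y₁ +
y₂⟩ = 2 T`, while `|y₁ + y₂|² = 4 (1 - κ)`. Cauchy–Schwarz bounds `T²`, so `|ζ|² - T²` is
quantitatively positive. -/
theorem transverse_bounds {y₁ y₂ : E} (h₁ : ‖y₁‖ = 1) (h₂ : ‖y₂‖ = 1) (h : y₁ ≠ y₂)
    (ξ : E) (τ : ℝ) :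
    nullGap y₁ y₂ * ‖transverse y₁ y₂ ξ τ‖ ^ 2
        ≤ ‖ξ‖ ^ 2 - τ ^ 2 + (τ - inner ℝ ξ y₁) * (τ - inner ℝ ξ y₂) / nullGap y₁ y₂ ∧
      (τ - ((τ - inner ℝ ξ y₁) + (τ - inner ℝ ξ y₂)) / (2 * nullGap y₁ y₂)) ^ 2
        ≤ (1 - nullGap y₁ y₂) * ‖transverse y₁ y₂ ξ τ‖ ^ 2 := by
  have hκ := nullGap_pos h₁ h₂ h
  set κ := nullGap y₁ y₂ with hκd
  have hc : inner ℝ y₁ y₂ = 1 - 2 * κ := by rw [hκd, nullGap]; ring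
  have hc' : inner ℝ y₂ y₁ = 1 - 2 * κ := by rw [real_inner_comm, hc]
  set a := inner ℝ ξ y₁ with ha
  set b := inner ℝ ξ y₂ with hb
  set ζ := transverse y₁ y₂ ξ τ with hζ
  have h11 : inner ℝ y₁ y₁ = (1 : ℝ) := by rw [real_inner_self_eq_norm_sq, h₁]; norm_num
  have h22 : inner ℝ y₂ y₂ = (1 : ℝ) := by rw [real_inner_self_eq_norm_sq, h₂]; norm_num
  have e1 : inner ℝ ζ (y₁ + y₂) = 2 * (τ - ((τ - a) + (τ - b)) / (2 * κ)) := by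
    simp only [hζ, transverse, inner_sub_left, inner_add_right, inner_smul_left, inner_add_left,
      h11, h22, hc, hc', ← ha, ← hb, ← hκd]
    simp
    field_simp
    ring
  have e2 : ‖y₁ + y₂‖ ^ 2 = 4 * (1 - κ) := by
    rw [norm_add_sq_real, h₁, h₂, hc]; ring
  have e3 : ‖ζ‖ ^ 2 = ‖ξ‖ ^ 2 - ((τ - b) * a + (τ - a) * b) / κ
      + ((τ - b) ^ 2 + (τ - a) ^ 2 + 2 * (τ - a) * (τ - b) * (1 - 2 * κ)) / (4 * κ ^ 2) := by
    rw [hζ, transverse, norm_sub_sq_real, ← hκd, ← ha, ← hb, norm_smul, mul_pow, norm_add_sq_real,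
      norm_smul, norm_smul, h₁, h₂]
    simp only [inner_smul_left, inner_smul_right, inner_add_right, hc, ← ha, ← hb]
    simp [abs_of_pos hκ]
    field_simp
    ring
  have e4 : (2 * (τ - ((τ - a) + (τ - b)) / (2 * κ))) ^ 2 ≤ ‖ζ‖ ^ 2 * (4 * (1 - κ)) := by
    rw [← e1, ← e2, ← mul_pow]
    exact sq_le_sq' (neg_le_of_abs_le (abs_real_inner_le_norm _ _)) (real_inner_le_norm _ _)
  refine ⟨?_, by nlinarith⟩
  have e5 : ‖ξ‖ ^ 2 - τ ^ 2 + (τ - a) * (τ - b) / κ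
      = ‖ζ‖ ^ 2 - (τ - ((τ - a) + (τ - b)) / (2 * κ)) ^ 2 := by
    rw [e3]; field_simp; ring
  rw [e5]
  nlinarith

theorem lorentz_norm_add_nonneg {y₁ y₂ : E} (h₁ : ‖y₁‖ = 1) (h₂ : ‖y₂‖ = 1) (h : y₁ ≠ y₂)
    (ξ : E) (τ : ℝ) :
    0 ≤ ‖ξ‖ ^ 2 - τ ^ 2 + (τ - inner ℝ ξ y₁) * (τ - inner ℝ ξ y₂) / nullGap y₁ y₂ :=
  (mul_nonneg (nullGap_pos h₁ h₂ h).le (sq_nonneg _)).trans (transverse_bounds h₁ h₂ h ξ τ).1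

end Splitting

/-! ### The comparison form -/

theorem inner_toLp (v w : Fin n → ℝ) :
    inner ℝ (WithLp.toLp 2 v : EuclideanSpace ℝ (Fin n)) (WithLp.toLp 2 w) = v ⬝ᵥ w := by
  rw [EuclideanSpace.inner_eq_star_dotProduct]; simp [dotProduct_comm]

/-- The matrix is minus the Hessian of `Φ_ε` restricted to the tangent vectors `(v, p · v)`. Its
`sigma` is `24 ε² - 16 ε k w + 2 k² (w² - q₁ q₂)`: the last term is nonpositive by Cauchy–Schwarz
for `S`, and `w ≥ -κ` leaves `24 ε² + 16 ε (1 - ε) ≤ 24 ε`. -/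
theorem sigma_comparison_le {p : Fin 3 → ℝ} (hp : p ⬝ᵥ p < 1) {y₁ y₂ : EuclideanSpace ℝ (Fin 3)}
    (h₁ : ‖y₁‖ = 1) (h₂ : ‖y₂‖ = 1) (h : y₁ ≠ y₂) {ε k : ℝ} (hε : 0 ≤ ε) (hε1 : ε ≤ 1)
    (hk : k = (1 - ε) / nullGap y₁ y₂) :
    sigma (metricInv p) ((2 * ε) • (1 - vecMulVec p p)
      - k • (vecMulVec (p - y₁.ofLp) (p - y₂.ofLp) + vecMulVec (p - y₂.ofLp) (p - y₁.ofLp)))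
      ≤ 24 * ε := by
  have hκ := nullGap_pos h₁ h₂ h
  have hQ := lorentz_norm_add_nonneg h₁ h₂ h (WithLp.toLp 2 p) 1
  set κ := nullGap y₁ y₂ with hκd
  set S := metricInv p with hS
  set ξ := p - y₁.ofLp with hξ
  set η := p - y₂.ofLp with hη
  have hSs : S.PosSemidef := metricInv_posSemidef hp
  have hSt : Sᵀ = S := by simpa [IsHermitian] using hSs.1
  have hSg : S * (1 - vecMulVec p p) = 1 := mul_eq_one_comm.1 (one_sub_mul_metricInv hp)
  set w := ξ ⬝ᵥ S *ᵥ η with hw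
  set q₁ := ξ ⬝ᵥ S *ᵥ ξ with hq₁
  set q₂ := η ⬝ᵥ S *ᵥ η with hq₂
  have hsym : ∀ a b : Fin 3 → ℝ, a ⬝ᵥ S *ᵥ b = b ⬝ᵥ S *ᵥ a := by
    intro a b
    rw [dotProduct_mulVec, ← mulVec_transpose, hSt, dotProduct_comm]
  have hCS : w ^ 2 ≤ q₁ * q₂ := by
    have : ∀ s : ℝ, 0 ≤ q₁ * (s * s) + 2 * w * s + q₂ := by
      intro s
      have := hSs.dotProduct_mulVec_nonneg (s • ξ + η)
      simp only [star_trivial, mulVec_add, dotProduct_add, add_dotProduct, mulVec_smul,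
        smul_dotProduct, dotProduct_smul, smul_eq_mul, hsym η ξ] at this
      linarith
    have := discrim_le_zero this
    simp only [discrim] at this
    linarith
  have hD : 0 < 1 - p ⬝ᵥ p := by linarith
  have hy12 : y₁.ofLp ⬝ᵥ y₂.ofLp = 1 - 2 * κ := by
    rw [← inner_toLp, hκd, nullGap]; simp; ring
  have hpy : ∀ y : EuclideanSpace ℝ (Fin 3),
      inner ℝ (WithLp.toLp 2 p : EuclideanSpace ℝ (Fin 3)) y = p ⬝ᵥ y.ofLp :=
    fun y => inner_toLp p y.ofLp
  -- This is `lorentz_norm_add_nonneg` at the timelike vector `(p, 1)`.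
  have hw1 : -κ ≤ w := by
    have hn : ‖(WithLp.toLp 2 p : EuclideanSpace ℝ (Fin 3))‖ ^ 2 = p ⬝ᵥ p := by
      rw [← real_inner_self_eq_norm_sq, inner_toLp]
    rw [hpy, hpy, hn] at hQ
    have hwe : w = (1 - p ⬝ᵥ y₁.ofLp) * (1 - p ⬝ᵥ y₂.ofLp) / (1 - p ⬝ᵥ p) - 2 * κ := by
      simp only [hw, hS, metricInv, add_mulVec, one_mulVec, smul_mulVec, vecMulVec_mulVec,
        dotProduct_add, dotProduct_smul, hξ, hη, sub_dotProduct, dotProduct_sub, smul_eq_mul,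
        dotProduct_comm _ p, hy12, op_smul_eq_smul]
      field_simp
      ring
    rw [hwe]
    have : κ ≤ (1 - p ⬝ᵥ y₁.ofLp) * (1 - p ⬝ᵥ y₂.ofLp) / (1 - p ⬝ᵥ p) := by
      rw [le_div_iff₀ hD]
      have h5 : (1 - p ⬝ᵥ p) ≤ (1 - p ⬝ᵥ y₁.ofLp) * (1 - p ⬝ᵥ y₂.ofLp) / κ := by linarith
      rw [le_div_iff₀ hκ] at h5
      linarith
    linarith
  have hmv : ∀ a b : Fin 3 → ℝ, S * vecMulVec a b = vecMulVec (S *ᵥ a) b := fun a b => by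
    rw [mul_vecMulVec]
  have hSB : S * ((2 * ε) • (1 - vecMulVec p p) - k • (vecMulVec ξ η + vecMulVec η ξ))
      = (2 * ε) • (1 : Matrix (Fin 3) (Fin 3) ℝ)
        - k • (vecMulVec (S *ᵥ ξ) η + vecMulVec (S *ᵥ η) ξ) := by
    rw [mul_sub, mul_smul_comm, hSg, mul_smul_comm, mul_add, hmv, hmv]
  have htr : ∀ a b : Fin 3 → ℝ, (vecMulVec a b).trace = a ⬝ᵥ b := trace_vecMulVec
  have c1 : S *ᵥ ξ ⬝ᵥ η = w := by rw [dotProduct_comm, hsym]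
  have c2 : S *ᵥ η ⬝ᵥ ξ = w := by rw [dotProduct_comm]
  have c3 : S *ᵥ ξ ⬝ᵥ ξ = q₁ := by rw [dotProduct_comm]
  have c4 : S *ᵥ η ⬝ᵥ η = q₂ := by rw [dotProduct_comm]
  have key : sigma S ((2 * ε) • (1 - vecMulVec p p) - k • (vecMulVec ξ η + vecMulVec η ξ))
      = 24 * ε ^ 2 - 16 * ε * k * w + 2 * k ^ 2 * (w ^ 2 - q₁ * q₂) := by
    simp only [sigma, hSB]
    simp only [mul_sub, sub_mul, mul_add, add_mul, smul_mul_assoc, mul_smul_comm, mul_one, one_mul,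
      trace_sub, trace_add, trace_smul, htr, vecMulVec_mul_vecMulVec, trace_one, smul_eq_mul,
      Fintype.card_fin, c1, c2, vecMulVec_smul, dotProduct_comm ξ (S *ᵥ _),
      dotProduct_comm η (S *ᵥ _), c3, c4]
    push_cast
    ring
  rw [key]
  have hk0 : 0 ≤ k := by rw [hk]; exact div_nonneg (by linarith) hκ.le
  have hkκ : k * κ = 1 - ε := by rw [hk]; field_simp
  have i1 : 2 * k ^ 2 * (w ^ 2 - q₁ * q₂) ≤ 0 :=
    mul_nonpos_of_nonneg_of_nonpos (by positivity) (by linarith)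
  have i2 : ε * k * (-κ) ≤ ε * k * w := mul_le_mul_of_nonneg_left hw1 (by positivity)
  have i3 : ε * k * (-κ) = - (ε * (1 - ε)) := by rw [← hkκ]; ring
  nlinarith

/-! ### Gradient of the barrier functions: Lorentzian length and time orientation. -/

section Splitting

variable {E : Type*} [NormedAddCommGroup E] [InnerProductSpace ℝ E]

/-- The quadratic form `(1 - ε) α β / κ + ε (τ² - |ξ|²)` of `(ξ, τ)`, where `α = τ - ⟨ξ, y₁⟩`,
`β = τ - ⟨ξ, y₂⟩` and `κ = nullGap y₁ y₂`. -/
def squashedForm (y₁ y₂ : E) (ε : ℝ) (ξ : E) (τ : ℝ) : ℝ :=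
  (1 - ε) / nullGap y₁ y₂ * ((τ - inner ℝ ξ y₁) * (τ - inner ℝ ξ y₂)) + ε * (τ ^ 2 - ‖ξ‖ ^ 2)

/-- The time component of half the gradient of `squashedForm`. -/
def squashedTime (y₁ y₂ : E) (ε : ℝ) (ξ : E) (τ : ℝ) : ℝ :=
  (1 - ε) / nullGap y₁ y₂ * ((τ - inner ℝ ξ y₁) + (τ - inner ℝ ξ y₂)) + 2 * ε * τ

/-- The space component of the gradient of `squashedForm`, up to sign. -/
def squashedSpace (y₁ y₂ : E) (ε : ℝ) (ξ : E) (τ : ℝ) : E :=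
  ((1 - ε) / nullGap y₁ y₂) • ((τ - inner ℝ ξ y₂) • y₁ + (τ - inner ℝ ξ y₁) • y₂) + (2 * ε) • ξ

theorem squashedForm_le {y₁ y₂ : E} (h₁ : ‖y₁‖ = 1) (h₂ : ‖y₂‖ = 1) (h : y₁ ≠ y₂) {ε : ℝ}
    (hε : 0 ≤ ε) (ξ : E) (τ : ℝ) :
    squashedForm y₁ y₂ ε ξ τ
      ≤ (τ - inner ℝ ξ y₁) * (τ - inner ℝ ξ y₂) / nullGap y₁ y₂ := by
  have := mul_nonneg hε (lorentz_norm_add_nonneg h₁ h₂ h ξ τ)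
  simp only [squashedForm]
  have e : (1 - ε) / nullGap y₁ y₂ * ((τ - inner ℝ ξ y₁) * (τ - inner ℝ ξ y₂))
      = (τ - inner ℝ ξ y₁) * (τ - inner ℝ ξ y₂) / nullGap y₁ y₂
        - ε * ((τ - inner ℝ ξ y₁) * (τ - inner ℝ ξ y₂) / nullGap y₁ y₂) := by ring
  rw [e]
  linarith

/-- The right side equals `4 (ε Φ + (1 - ε) α β / κ)`, and `Φ ≤ α β / κ`. -/
theorem four_mul_squashedForm_le {y₁ y₂ : E} (h₁ : ‖y₁‖ = 1) (h₂ : ‖y₂‖ = 1) (h : y₁ ≠ y₂) {ε : ℝ}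
    (hε : 0 ≤ ε) (hε1 : ε ≤ 1) (ξ : E) (τ : ℝ) :
    4 * squashedForm y₁ y₂ ε ξ τ
      ≤ squashedTime y₁ y₂ ε ξ τ ^ 2 - ‖squashedSpace y₁ y₂ ε ξ τ‖ ^ 2 := by
  have hκ := nullGap_pos h₁ h₂ h
  have hle := squashedForm_le h₁ h₂ h hε ξ τ
  have hc : inner ℝ y₁ y₂ = 1 - 2 * nullGap y₁ y₂ := by rw [nullGap]; ring
  have hform : squashedForm y₁ y₂ ε ξ τ = (1 - ε) / nullGap y₁ y₂ *
    ((τ - inner ℝ ξ y₁) * (τ - inner ℝ ξ y₂)) + ε * (τ ^ 2 - ‖ξ‖ ^ 2) := rfl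
  set Φ := squashedForm y₁ y₂ ε ξ τ
  set κ := nullGap y₁ y₂ with hκd
  have hw : ‖squashedSpace y₁ y₂ ε ξ τ‖ ^ 2
      = ((1 - ε) / κ) ^ 2 * ((τ - inner ℝ ξ y₂) ^ 2 + (τ - inner ℝ ξ y₁) ^ 2
          + 2 * (τ - inner ℝ ξ y₁) * (τ - inner ℝ ξ y₂) * (1 - 2 * κ))
        + 4 * ε * ((1 - ε) / κ) * ((τ - inner ℝ ξ y₂) * inner ℝ ξ y₁
          + (τ - inner ℝ ξ y₁) * inner ℝ ξ y₂) + 4 * ε ^ 2 * ‖ξ‖ ^ 2 := by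
    rw [squashedSpace, norm_add_sq_real, norm_smul, mul_pow, norm_add_sq_real, norm_smul, norm_smul,
      norm_smul, h₁, h₂]
    simp only [inner_smul_left, inner_smul_right, inner_add_right, hc, real_inner_comm ξ]
    simp only [Real.norm_eq_abs, mul_pow, sq_abs, conj_trivial, ← hκd]
    ring
  have ht : squashedTime y₁ y₂ ε ξ τ = (1 - ε) / κ * ((τ - inner ℝ ξ y₁) + (τ - inner ℝ ξ y₂))
    + 2 * ε * τ := rfl
  rw [hw, ht]
  set a := inner ℝ ξ y₁
  set b := inner ℝ ξ y₂
  have hkey : ((1 - ε) / κ * ((τ - a) + (τ - b)) + 2 * ε * τ) ^ 2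
      - (((1 - ε) / κ) ^ 2 * ((τ - b) ^ 2 + (τ - a) ^ 2
          + 2 * (τ - a) * (τ - b) * (1 - 2 * κ))
        + 4 * ε * ((1 - ε) / κ) * ((τ - b) * a + (τ - a) * b) + 4 * ε ^ 2 * ‖ξ‖ ^ 2)
      = 4 * (ε * Φ + (1 - ε) * ((τ - a) * (τ - b) / κ)) := by
    rw [hform]; field_simp; ring
  rw [hkey]
  nlinarith [mul_le_mul_of_nonneg_left hle (sub_nonneg.2 hε1)]

/-- The quantity is `(α + β) / κ + 2 ε T` with `T` the transverse time component. `Φ > 0` bounds the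
transverse part by `α β`, and AM–GM then makes the first summand dominate. -/
theorem squashedTime_pos {y₁ y₂ : E} (h₁ : ‖y₁‖ = 1) (h₂ : ‖y₂‖ = 1) (h : y₁ ≠ y₂) {ε : ℝ}
    (hε : 0 ≤ ε) (hε1 : ε ≤ 1) {ξ : E} {τ : ℝ} (hα : 0 < τ - inner ℝ ξ y₁)
    (hβ : 0 < τ - inner ℝ ξ y₂) (hΦ : 0 < squashedForm y₁ y₂ ε ξ τ) :
    0 < squashedTime y₁ y₂ ε ξ τ := by
  have hκ := nullGap_pos h₁ h₂ h
  have hκ1 := nullGap_le_one h₁ h₂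
  obtain ⟨b1, b2⟩ := transverse_bounds h₁ h₂ h ξ τ
  have hform : squashedForm y₁ y₂ ε ξ τ = (1 - ε) / nullGap y₁ y₂ *
    ((τ - inner ℝ ξ y₁) * (τ - inner ℝ ξ y₂)) + ε * (τ ^ 2 - ‖ξ‖ ^ 2) := rfl
  have ht : squashedTime y₁ y₂ ε ξ τ = (1 - ε) / nullGap y₁ y₂ *
    ((τ - inner ℝ ξ y₁) + (τ - inner ℝ ξ y₂)) + 2 * ε * τ := rfl
  rw [hform] at hΦ
  rw [ht]
  set κ := nullGap y₁ y₂ with hκd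
  set α := τ - inner ℝ ξ y₁ with hαd
  set β := τ - inner ℝ ξ y₂ with hβd
  set Z := ‖transverse y₁ y₂ ξ τ‖ ^ 2
  have hZ : 0 ≤ Z := sq_nonneg _
  set T := τ - (α + β) / (2 * κ) with hT
  have e1 : (1 - ε) / κ * (α + β) + 2 * ε * τ = (α + β) / κ + 2 * ε * T := by
    rw [hT]; field_simp; ring
  have e2 : ε * (κ * Z) < α * β / κ := by
    have : (1 - ε) / κ * (α * β) = α * β / κ - ε * (α * β / κ) := by ring
    nlinarith [mul_le_mul_of_nonneg_left b1 hε]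
  have e3 : (2 * ε * T) ^ 2 < ((α + β) / κ) ^ 2 := by
    have i1 : ε ^ 2 * T ^ 2 ≤ ε * Z := by
      have : T ^ 2 ≤ Z := b2.trans (by nlinarith)
      calc ε ^ 2 * T ^ 2 ≤ ε * T ^ 2 := by
            apply mul_le_mul_of_nonneg_right _ (sq_nonneg _); nlinarith
        _ ≤ ε * Z := mul_le_mul_of_nonneg_left this hε
    have i2 : ε * Z < α * β / κ ^ 2 := by
      rw [lt_div_iff₀ (by positivity)]
      rw [lt_div_iff₀ hκ] at e2
      linarith
    have i3 : 4 * (α * β / κ ^ 2) ≤ ((α + β) / κ) ^ 2 := by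
      rw [div_pow, ← mul_div_assoc]
      apply div_le_div_of_nonneg_right _ (by positivity)
      nlinarith [sq_nonneg (α - β)]
    nlinarith
  have e4 := (abs_lt_of_sq_lt_sq e3 (by positivity))
  rw [e1]
  linarith [(abs_lt.1 e4).1]

end Splitting

/-! ### The maximum principle -/

theorem deriv_eq_zero_and_second_nonpos {g g' : ℝ → ℝ} {d : ℝ} (hg : ∀ s, HasDerivAt g (g' s) s)
    (hg' : HasDerivAt g' d 0) (hmax : IsLocalMax g 0) : g' 0 = 0 ∧ d ≤ 0 := by
  have h0 : g' 0 = 0 := hmax.hasDerivAt_eq_zero (hg 0)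
  refine ⟨h0, ?_⟩
  by_contra! hd
  have hder : deriv g = g' := funext fun s => (hg s).deriv
  -- A point that is both a local maximum and a local minimum makes `g` locally constant, so `d =
  -- 0`.
  have hmin : IsLocalMin g 0 := isLocalMin_of_deriv_deriv_pos (by rw [hder, hg'.deriv]; exact hd)
    (by rw [hder, h0]) (hg 0).continuousAt
  have hconst : g =ᶠ[nhds 0] fun _ => g 0 := by
    filter_upwards [hmax, hmin] with s h1 h2 using le_antisymm h1 h2
  have : deriv g =ᶠ[nhds 0] fun _ => 0 := by
    have := hconst.deriv
    simpa using this
  rw [hder] at this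
  have h2 := this.deriv_eq
  rw [hg'.deriv] at h2
  simp at h2
  linarith

theorem fderiv_apply_eq {u : EuclideanSpace ℝ (Fin n) → ℝ} (x v : EuclideanSpace ℝ (Fin n)) :
    fderiv ℝ u x v = grad u x ⬝ᵥ v.ofLp := by
  have : v = ∑ i, v.ofLp i • EuclideanSpace.single i (1 : ℝ) := by
    ext j
    simp [Finset.sum_apply, Pi.single_apply]
  conv_lhs => rw [this, map_sum]
  simp [dotProduct, grad, partialDeriv, mul_comm]

theorem fderiv_fderiv_apply_eq {u : EuclideanSpace ℝ (Fin n) → ℝ} (hu : ContDiff ℝ ∞ u)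
    (x v : EuclideanSpace ℝ (Fin n)) :
    fderiv ℝ (fderiv ℝ u) x v v = v.ofLp ⬝ᵥ hess u x *ᵥ v.ofLp := by
  have : v = ∑ i, v.ofLp i • EuclideanSpace.single i (1 : ℝ) := by
    ext j
    simp [Finset.sum_apply, Pi.single_apply]
  conv_lhs => rw [this, map_sum]
  simp only [map_smul, _root_.sum_apply, map_sum, _root_.smul_apply,
    dotProduct, mulVec, hess, of_apply, partialDeriv_partialDeriv hu, smul_eq_mul, Finset.mul_sum]
  rw [Finset.sum_comm]
  refine Finset.sum_congr rfl fun i _ => Finset.sum_congr rfl fun j _ => ?_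
  ring

/-- The height function has positive mean curvature and scalar curvature at most `-c`. -/
structure IsAdmissible (u : EuclideanSpace ℝ (Fin 3) → ℝ) (c : ℝ) : Prop where
  spacelike : IsSpacelikeFunction u
  pos : 0 < c
  trace_pos : ∀ x, 0 < (metricInv (grad u x) * hess u x).trace
  le_sigma : ∀ x, c * (1 - grad u x ⬝ᵥ grad u x) ≤ sigma (metricInv (grad u x)) (hess u x)

theorem hasDerivAt_line {u : EuclideanSpace ℝ (Fin n) → ℝ} (hu : ContDiff ℝ ∞ u)
    (x v : EuclideanSpace ℝ (Fin n)) (s : ℝ) :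
    HasDerivAt (fun s : ℝ => u (x + s • v)) (fderiv ℝ u (x + s • v) v) s := by
  have h1 : HasDerivAt (fun s : ℝ => x + s • v) v s := by
    simpa using ((hasDerivAt_id s).smul_const v).const_add x
  exact ((hu.differentiable (by simp)) (x + s • v)).hasFDerivAt.comp_hasDerivAt s h1

theorem hasDerivAt_fderiv_line {u : EuclideanSpace ℝ (Fin n) → ℝ} (hu : ContDiff ℝ ∞ u)
    (x v : EuclideanSpace ℝ (Fin n)) :
    HasDerivAt (fun s : ℝ => fderiv ℝ u (x + s • v) v) (fderiv ℝ (fderiv ℝ u) x v v) 0 := by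
  have h1 : HasDerivAt (fun s : ℝ => x + s • v) v 0 := by
    simpa using ((hasDerivAt_id (0 : ℝ)).smul_const v).const_add x
  have hd : DifferentiableAt ℝ (fderiv ℝ u) (x + (0 : ℝ) • v) :=
    ((hu.fderiv_right (m := ∞) (by simp)).differentiable (by simp)) _
  have h2 := hd.hasFDerivAt.comp_hasDerivAt (0 : ℝ) h1
  simp only [zero_smul, add_zero] at h2
  have h3 := h2.clm_apply (hasDerivAt_const (0 : ℝ) v)
  simpa using h3

/-- With `Θ = ∂_τ Φ` and `W = -∂_ξ Φ`, criticality gives `Θ p = W` and the second-order condition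
gives `Θ h ≤ B`. Hence `4 c Φ ≤ c (Θ² - |W|²) = c Θ² (1 - |p|²) ≤ sigma (Θ h) ≤ sigma B ≤ 24 ε`. -/
theorem squashedForm_le_of_isLocalMax {u : EuclideanSpace ℝ (Fin 3) → ℝ} {c : ℝ}
    (hu : IsAdmissible u c) {y₁ y₂ : EuclideanSpace ℝ (Fin 3)} (h₁ : ‖y₁‖ = 1) (h₂ : ‖y₂‖ = 1)
    (h : y₁ ≠ y₂) {ε : ℝ} (hε : 0 ≤ ε) (hε1 : ε ≤ 1) {x₀ x : EuclideanSpace ℝ (Fin 3)} {t₀ : ℝ}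
    (hα : 0 < u x - t₀ - inner ℝ (x - x₀) y₁) (hβ : 0 < u x - t₀ - inner ℝ (x - x₀) y₂)
    (hΦ : 0 < squashedForm y₁ y₂ ε (x - x₀) (u x - t₀))
    (hmax : IsLocalMax (fun z => squashedForm y₁ y₂ ε (z - x₀) (u z - t₀)) x) :
    c * squashedForm y₁ y₂ ε (x - x₀) (u x - t₀) ≤ 6 * ε := by
  have hp := grad_dotProduct_lt_one hu.spacelike x
  set p := grad u x with hpd
  set k := (1 - ε) / nullGap y₁ y₂ with hk
  set Θ := squashedTime y₁ y₂ ε (x - x₀) (u x - t₀) with hΘ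
  have hΘpos : 0 < Θ := squashedTime_pos h₁ h₂ h hε hε1 hα hβ hΦ
  -- The first and second variations are computed along the line `x + s v`.
  have hvar : ∀ v : EuclideanSpace ℝ (Fin 3),
      Θ * (p ⬝ᵥ v.ofLp) = inner ℝ (squashedSpace y₁ y₂ ε (x - x₀) (u x - t₀)) v ∧
      Θ * (v.ofLp ⬝ᵥ hess u x *ᵥ v.ofLp) ≤ 2 * ε * (‖v‖ ^ 2 - (p ⬝ᵥ v.ofLp) ^ 2)
        - 2 * k * ((p ⬝ᵥ v.ofLp - inner ℝ v y₁) * (p ⬝ᵥ v.ofLp - inner ℝ v y₂)) := by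
    intro v
    have hf := hasDerivAt_line hu.spacelike.smooth x v
    have hf' := hasDerivAt_fderiv_line hu.spacelike.smooth x v
    set f := fun s : ℝ => u (x + s • v) with hfd
    set f' := fun s : ℝ => fderiv ℝ u (x + s • v) v with hfd'
    have hlin : ∀ y : EuclideanSpace ℝ (Fin 3), ∀ s : ℝ, HasDerivAt
        (fun s : ℝ => f s - t₀ - (inner ℝ (x - x₀) y + s * inner ℝ v y))
        (f' s - inner ℝ v y) s := fun y s => by
      have := ((hf s).sub_const t₀).sub (((hasDerivAt_id s).mul_const (inner ℝ v y)).const_add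
        (inner ℝ (x - x₀) y))
      exact this.congr_deriv (by simp [hfd'])
    have hq : ∀ s : ℝ, HasDerivAt (fun s : ℝ => (f s - t₀) ^ 2 - (‖x - x₀‖ ^ 2
        + 2 * s * inner ℝ (x - x₀) v + s ^ 2 * ‖v‖ ^ 2))
        (2 * (f s - t₀) * f' s - (2 * inner ℝ (x - x₀) v + 2 * s * ‖v‖ ^ 2)) s := fun s => by
      have h1 := ((hf s).sub_const t₀).pow 2
      have h2 := ((((hasDerivAt_id s).const_mul 2).mul_const (inner ℝ (x - x₀) v)).const_add
        (‖x - x₀‖ ^ 2)).add (((hasDerivAt_id s).pow 2).mul_const (‖v‖ ^ 2))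
      have := h1.sub h2
      exact this.congr_deriv (by simp [hfd'])
    set g := fun s : ℝ => k * ((f s - t₀ - (inner ℝ (x - x₀) y₁ + s * inner ℝ v y₁))
      * (f s - t₀ - (inner ℝ (x - x₀) y₂ + s * inner ℝ v y₂)))
      + ε * ((f s - t₀) ^ 2 - (‖x - x₀‖ ^ 2 + 2 * s * inner ℝ (x - x₀) v + s ^ 2 * ‖v‖ ^ 2)) with hg
    have hgd := fun s => (((hlin y₁ s).mul (hlin y₂ s)).const_mul k).add ((hq s).const_mul ε)
    have hgd2 := ((((hf'.sub_const (inner ℝ v y₁)).mul (hlin y₂ 0)).add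
      ((hlin y₁ 0).mul (hf'.sub_const (inner ℝ v y₂)))).const_mul k).add
      (((((((hf 0).sub_const t₀).const_mul 2).mul hf')).sub
        ((((hasDerivAt_id (0:ℝ)).const_mul 2).mul_const (‖v‖ ^ 2)).const_add
          (2 * inner ℝ (x - x₀) v))).const_mul ε)
    have hgeq : g = fun s : ℝ => squashedForm y₁ y₂ ε (x + s • v - x₀) (u (x + s • v) - t₀) := by
      funext s
      have : x + s • v - x₀ = (x - x₀) + s • v := by abel
      simp only [hg, squashedForm, this, inner_add_left, inner_smul_left, norm_add_sq_real,
        inner_smul_right, norm_smul, mul_pow, hfd]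
      simp
      rw [hk]
      ring
    have hgmax : IsLocalMax g 0 := by
      rw [hgeq]
      have hc : ContinuousAt (fun s : ℝ => x + s • v) 0 := by fun_prop
      have := hc.tendsto.eventually (p := fun z => squashedForm y₁ y₂ ε (z - x₀) (u z - t₀)
        ≤ squashedForm y₁ y₂ ε (x - x₀) (u x - t₀)) 
        (by rw [zero_smul, add_zero]; exact hmax)
      filter_upwards [this] with s hs
      simpa using hs
    obtain ⟨e1, e2⟩ := deriv_eq_zero_and_second_nonpos (g := g) hgd hgd2 hgmax
    have f0 : f 0 = u x := by simp [hfd]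
    have f0' : f' 0 = p ⬝ᵥ v.ofLp := by simp [hfd', fderiv_apply_eq, hpd]
    have f0'' : fderiv ℝ u (x + (0 : ℝ) • v) v = p ⬝ᵥ v.ofLp := f0'
    have hΘe : Θ = k * ((u x - t₀ - inner ℝ (x - x₀) y₁) + (u x - t₀ - inner ℝ (x - x₀) y₂))
      + 2 * ε * (u x - t₀) := rfl
    rw [fderiv_fderiv_apply_eq hu.spacelike.smooth] at e2
    simp only [f0, f0', f0'', zero_mul, mul_zero, add_zero] at e1 e2
    constructor
    · rw [squashedSpace, inner_add_left, inner_smul_left, inner_add_left, inner_smul_left,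
        inner_smul_left, inner_smul_left, ← hk, real_inner_comm v y₁, real_inner_comm v y₂]
      simp only [conj_trivial]
      rw [hΘe]
      linarith
    · rw [hΘe]
      linarith
  have hs := hess_isSymm hu.spacelike.smooth x
  have hnorm : ∀ v : EuclideanSpace ℝ (Fin 3), ‖v‖ ^ 2 = v.ofLp ⬝ᵥ v.ofLp := fun v => by
    rw [← inner_toLp, ← real_inner_self_eq_norm_sq]
  have hpsd : ((2 * ε) • (1 - vecMulVec p p)
      - k • (vecMulVec (p - y₁.ofLp) (p - y₂.ofLp) + vecMulVec (p - y₂.ofLp) (p - y₁.ofLp))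
      - Θ • hess u x).PosSemidef := by
    refine PosSemidef.of_dotProduct_mulVec_nonneg ?_ ?_
    · rw [IsHermitian, conjTranspose_eq_transpose_of_trivial]
      simp only [transpose_sub, transpose_add, transpose_smul, transpose_vecMulVec, transpose_one,
        hs.eq]
      rw [add_comm (vecMulVec (p - y₂.ofLp) _)]
    · intro v
      have hv := (hvar (WithLp.toLp 2 v)).2
      rw [hnorm, ← inner_toLp] at hv
      have i1 : ∀ y : EuclideanSpace ℝ (Fin 3),
          inner ℝ (WithLp.toLp 2 v : EuclideanSpace ℝ (Fin 3)) y = v ⬝ᵥ y.ofLp :=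
        fun y => inner_toLp v y.ofLp
      simp only [i1] at hv
      simp only [star_trivial, sub_mulVec, add_mulVec, smul_mulVec, one_mulVec, vecMulVec_mulVec,
        add_dotProduct, smul_dotProduct, smul_eq_mul, op_smul_eq_smul, sub_dotProduct,
        dotProduct_comm v]
      simp only [dotProduct_comm v] at hv
      linarith
  have hmono := sigma_mono (metricInv_posSemidef hp) (h := Θ • hess u x)
    (by rw [IsSymm, transpose_smul, hs.eq]) hpsd
    (by rw [mul_smul_comm, trace_smul, smul_eq_mul]; exact (mul_pos hΘpos (hu.trace_pos x)).le)
    (by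
      rw [sigma_smul]
      exact mul_nonneg (sq_nonneg _) ((mul_nonneg hu.pos.le (by linarith)).trans (hu.le_sigma x)))
  rw [sigma_smul] at hmono
  have hfin := hmono.trans (sigma_comparison_le hp h₁ h₂ h hε hε1 hk)
  have hW : Θ ^ 2 * (p ⬝ᵥ p) = ‖squashedSpace y₁ y₂ ε (x - x₀) (u x - t₀)‖ ^ 2 := by
    set W := squashedSpace y₁ y₂ ε (x - x₀) (u x - t₀)
    have e1 := (hvar W).1
    have e2 := (hvar (WithLp.toLp 2 p)).1
    have e3 : inner ℝ W (WithLp.toLp 2 p) = p ⬝ᵥ W.ofLp := by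
      rw [real_inner_comm]; exact inner_toLp p W.ofLp
    rw [real_inner_self_eq_norm_sq] at e1
    rw [e3] at e2
    simp only at e2
    rw [← e1, ← e2]; ring
  have h4 := four_mul_squashedForm_le h₁ h₂ h hε hε1 (x - x₀) (u x - t₀)
  rw [← hW, ← hΘ] at h4
  have h5 := mul_le_mul_of_nonneg_left (hu.le_sigma x) (sq_nonneg Θ)
  have h6 := mul_le_mul_of_nonneg_left h4 hu.pos.le
  nlinarith

/-! ### Causality for entire spacelike graphs -/

theorem IsSpacelikeFunction.sub_lt {u : EuclideanSpace ℝ (Fin n) → ℝ} (hu : IsSpacelikeFunction u)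
    {x z : EuclideanSpace ℝ (Fin n)} (h : x ≠ z) : u x - u z < ‖x - z‖ := by
  have hd := hasDerivAt_line hu.smooth z (x - z)
  obtain ⟨s, -, hs⟩ := exists_hasDerivAt_eq_slope (fun s : ℝ => u (z + s • (x - z)))
    (fun s => fderiv ℝ u (z + s • (x - z)) (x - z)) zero_lt_one
    (fun s _ => (hd s).continuousAt.continuousWithinAt) (fun s _ => hd s)
  have h1 : u x - u z = fderiv ℝ u (z + s • (x - z)) (x - z) := by
    rw [hs]; simp
  rw [h1]
  have h2 : 0 < ‖x - z‖ := norm_pos_iff.2 (sub_ne_zero.2 h)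
  calc _ ≤ ‖fderiv ℝ u (z + s • (x - z)) (x - z)‖ := le_abs_self _
    _ ≤ ‖fderiv ℝ u (z + s • (x - z))‖ * ‖x - z‖ := ContinuousLinearMap.le_opNorm _ _
    _ < 1 * ‖x - z‖ := mul_lt_mul_of_pos_right (hu.norm_fderiv_lt_one _) h2
    _ = ‖x - z‖ := one_mul _

theorem IsSpacelikeFunction.sub_le {u : EuclideanSpace ℝ (Fin n) → ℝ} (hu : IsSpacelikeFunction u)
    (x z : EuclideanSpace ℝ (Fin n)) : u x - u z ≤ ‖x - z‖ := by
  rcases eq_or_ne x z with rfl | h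
  · simp
  · exact (hu.sub_lt h).le

theorem IsSpacelikeFunction.continuous {u : EuclideanSpace ℝ (Fin n) → ℝ}
    (hu : IsSpacelikeFunction u) : Continuous u := hu.smooth.continuous

/-- The projection to `ℝⁿ` of the part of the graph of `u` in the causal future of `(x₀, t₀)`. -/
def futureShadow (u : EuclideanSpace ℝ (Fin n) → ℝ) (x₀ : EuclideanSpace ℝ (Fin n)) (t₀ : ℝ) :
    Set (EuclideanSpace ℝ (Fin n)) := {x | ‖x - x₀‖ ≤ u x - t₀}

/-- If infinitely much of the graph lies in the causal future of `(x₀, t₀)`, then the graph lies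
above a lightlike hyperplane through `(x₀, t₀)`. -/
theorem exists_support_of_not_isBounded {u : EuclideanSpace ℝ (Fin n) → ℝ}
    (hu : IsSpacelikeFunction u) {x₀ : EuclideanSpace ℝ (Fin n)} {t₀ : ℝ}
    (h : ¬ Bornology.IsBounded (futureShadow u x₀ t₀)) :
    ∃ w : EuclideanSpace ℝ (Fin n), ‖w‖ = 1 ∧ ∀ z, t₀ + inner ℝ (z - x₀) w ≤ u z := by
  have hex : ∀ N : ℕ, ∃ x ∈ futureShadow u x₀ t₀, (N : ℝ) + 1 < ‖x - x₀‖ := by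
    intro N
    by_contra! hN
    refine h ((Metric.isBounded_closedBall (x := x₀) (r := N + 1)).subset fun x hx => ?_)
    rw [mem_closedBall_iff_norm]
    exact hN x hx
  choose X hX hXN using hex
  have hpos : ∀ N, 0 < ‖X N - x₀‖ := fun N => lt_trans (by positivity) (hXN N)
  set W : ℕ → EuclideanSpace ℝ (Fin n) := fun N => ‖X N - x₀‖⁻¹ • (X N - x₀) with hW
  have hWs : ∀ N, W N ∈ Metric.sphere (0 : EuclideanSpace ℝ (Fin n)) 1 := by
    intro N
    rw [mem_sphere_zero_iff_norm, hW, norm_smul, norm_inv, norm_norm]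
    exact inv_mul_cancel₀ (hpos N).ne'
  obtain ⟨w, hw, φ, hφ, hlim⟩ := (isCompact_sphere _ _).tendsto_subseq hWs
  refine ⟨w, mem_sphere_zero_iff_norm.1 hw, fun z => ?_⟩
  have hkey : ∀ N, t₀ + inner ℝ (z - x₀) (W N) - ‖z - x₀‖ ^ 2 / (2 * (N + 1)) ≤ u z := by
    intro N
    have hr := hpos N
    set r := ‖X N - x₀‖ with hrd
    have hrW : X N - x₀ = r • W N := by
      rw [hW, smul_smul, mul_inv_cancel₀ hr.ne', one_smul]
    have hWn : ‖W N‖ = 1 := mem_sphere_zero_iff_norm.1 (hWs N)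
    set d := z - x₀ with hd
    have e1 : X N - z = r • W N - d := by rw [← hrW, hd]; abel
    have e2 : ‖X N - z‖ ^ 2 = r ^ 2 - 2 * r * inner ℝ d (W N) + ‖d‖ ^ 2 := by
      rw [e1, norm_sub_sq_real, norm_smul, hWn, inner_smul_left, real_inner_comm]
      simp; ring
    have hin : inner ℝ d (W N) ≤ ‖d‖ := by
      simpa [hWn] using real_inner_le_norm d (W N)
    -- The distance to a far point, minus `r`, is the Busemann function `-⟨d, W⟩` up to an error
    -- that vanishes as `r → ∞`.
    have e3 : ‖X N - z‖ ≤ r - inner ℝ d (W N) + ‖d‖ ^ 2 / (2 * r) := by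
      refine le_of_sq_le_sq ?_ ?_
      · rw [e2]
        have : (r - inner ℝ d (W N) + ‖d‖ ^ 2 / (2 * r)) ^ 2
            = r ^ 2 - 2 * r * inner ℝ d (W N) + ‖d‖ ^ 2
              + (inner ℝ d (W N) - ‖d‖ ^ 2 / (2 * r)) ^ 2 := by
          field_simp; ring
        rw [this]
        linarith [sq_nonneg (inner ℝ d (W N) - ‖d‖ ^ 2 / (2 * r))]
      · have : r - ‖d‖ + ‖d‖ ^ 2 / (2 * r) = ((r - ‖d‖) ^ 2 + r ^ 2) / (2 * r) := by
          field_simp; ring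
        have : 0 ≤ r - ‖d‖ + ‖d‖ ^ 2 / (2 * r) := by rw [this]; positivity
        linarith
    have e4 := hX N
    simp only [futureShadow, Set.mem_ofPred_eq] at e4
    have e5 := hu.sub_le (X N) z
    have e6 : ‖d‖ ^ 2 / (2 * r) ≤ ‖d‖ ^ 2 / (2 * (N + 1)) := by
      have := hXN N
      gcongr
    linarith
  have ht : Filter.Tendsto (fun N : ℕ => t₀ + inner ℝ (z - x₀) (W (φ N))
      - ‖z - x₀‖ ^ 2 / (2 * ((φ N : ℝ) + 1))) Filter.atTop
      (nhds (t₀ + inner ℝ (z - x₀) w - 0)) := by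
    refine Filter.Tendsto.sub ?_ ?_
    · exact (tendsto_const_nhds.inner hlim).const_add t₀
    · refine Filter.Tendsto.div_atTop tendsto_const_nhds ?_
      refine Filter.Tendsto.const_mul_atTop two_pos ?_
      exact Filter.tendsto_atTop_add_const_right _ _
        (tendsto_natCast_atTop_atTop.comp hφ.tendsto_atTop)
  rw [sub_zero] at ht
  exact le_of_tendsto' ht fun N => hkey (φ N)

/-! ### Comparison with complete hypersurfaces -/

section Comparison

variable {u : EuclideanSpace ℝ (Fin 3) → ℝ} {c : ℝ}

/-- On the compact superlevel set `Φ` attains its maximum. Since `0 < Φ ≤ α β / κ` there, neither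
`α` nor `β` vanishes, so the maximum is an unconstrained local one. -/
theorem squashedForm_le_of_isBounded (hu : IsAdmissible u c) {y₁ y₂ : EuclideanSpace ℝ (Fin 3)}
    (h₁ : ‖y₁‖ = 1) (h₂ : ‖y₂‖ = 1) (h : y₁ ≠ y₂) {ε : ℝ} (hε : 0 ≤ ε) (hε1 : ε ≤ 1)
    {x₀ x : EuclideanSpace ℝ (Fin 3)} {t₀ : ℝ}
    (hα : 0 ≤ u x - t₀ - inner ℝ (x - x₀) y₁) (hβ : 0 ≤ u x - t₀ - inner ℝ (x - x₀) y₂)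
    (hΦ : 0 < squashedForm y₁ y₂ ε (x - x₀) (u x - t₀))
    (hb : Bornology.IsBounded {z | 0 ≤ u z - t₀ - inner ℝ (z - x₀) y₁ ∧
      0 ≤ u z - t₀ - inner ℝ (z - x₀) y₂ ∧
      squashedForm y₁ y₂ ε (x - x₀) (u x - t₀) ≤ squashedForm y₁ y₂ ε (z - x₀) (u z - t₀)}) :
    c * squashedForm y₁ y₂ ε (x - x₀) (u x - t₀) ≤ 6 * ε := by
  have hc := hu.spacelike.continuous
  have hcα : ∀ y : EuclideanSpace ℝ (Fin 3),
      Continuous fun z => u z - t₀ - inner ℝ (z - x₀) y := fun y => by fun_prop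
  have hcΦ : Continuous fun z => squashedForm y₁ y₂ ε (z - x₀) (u z - t₀) := by
    unfold squashedForm; fun_prop
  have hK := Metric.isCompact_of_isClosed_isBounded ((isClosed_le continuous_const (hcα y₁)).inter
    ((isClosed_le continuous_const (hcα y₂)).inter (isClosed_le continuous_const hcΦ))) hb
  obtain ⟨m, ⟨hm1, hm2, hm3⟩, hmax⟩ := hK.exists_isMaxOn ⟨x, hα, hβ, le_refl (squashedForm _ _ _ _ _)⟩
    hcΦ.continuousOn
  simp only [Set.mem_ofPred_eq] at hm1 hm2 hm3
  have hpos := hΦ.trans_le hm3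
  have hprod := hpos.trans_le (squashedForm_le h₁ h₂ h hε _ _)
  rw [div_pos_iff_of_pos_right (nullGap_pos h₁ h₂ h)] at hprod
  have hm1' : 0 < u m - t₀ - inner ℝ (m - x₀) y₁ :=
    hm1.lt_of_ne fun h0 => by rw [← h0] at hprod; simp at hprod
  have hm2' : 0 < u m - t₀ - inner ℝ (m - x₀) y₂ :=
    hm2.lt_of_ne fun h0 => by rw [← h0] at hprod; simp at hprod
  have hloc : IsLocalMax (fun z => squashedForm y₁ y₂ ε (z - x₀) (u z - t₀)) m := by
    filter_upwards [(hcα y₁).continuousAt.eventually (lt_mem_nhds hm1'),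
      (hcα y₂).continuousAt.eventually (lt_mem_nhds hm2')] with z hz1 hz2
    by_cases hz : squashedForm y₁ y₂ ε (x - x₀) (u x - t₀)
        ≤ squashedForm y₁ y₂ ε (z - x₀) (u z - t₀)
    · exact hmax ⟨hz1.le, hz2.le, hz⟩
    · exact (not_le.1 hz).le.trans hm3
  exact (mul_le_mul_of_nonneg_left hm3 hu.pos.le).trans
    (squashedForm_le_of_isLocalMax hu h₁ h₂ h hε hε1 hm1' hm2' hpos hloc)

/-- Comparison with hyperboloids: the graph stays close to every point below it whose causal
future meets the graph in a bounded set. -/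
theorem lorentz_le_of_isBounded (hu : IsAdmissible u c) {x₀ : EuclideanSpace ℝ (Fin 3)} {t₀ : ℝ}
    (hb : Bornology.IsBounded (futureShadow u x₀ t₀)) {x : EuclideanSpace ℝ (Fin 3)}
    (hx : ‖x - x₀‖ ≤ u x - t₀) : c * ((u x - t₀) ^ 2 - ‖x - x₀‖ ^ 2) ≤ 6 := by
  -- At `ε = 1` the form no longer depends on the null directions; an antipodal pair is chosen so
  -- that `α + β ≥ 0` means `τ ≥ 0`.
  set y : EuclideanSpace ℝ (Fin 3) := EuclideanSpace.single 0 1 with hy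
  have hy1 : ‖y‖ = 1 := by simp [hy]
  have hy2 : ‖-y‖ = 1 := by rw [norm_neg, hy1]
  have hne : y ≠ -y := fun h0 => by
    have h2 : inner ℝ y y = inner ℝ y (-y) := by rw [← h0]
    rw [inner_neg_right, real_inner_self_eq_norm_sq, hy1] at h2
    norm_num at h2
  have hform : ∀ ξ τ, squashedForm y (-y) 1 ξ τ = τ ^ 2 - ‖ξ‖ ^ 2 := fun ξ τ => by
    simp [squashedForm]
  rcases le_or_gt ((u x - t₀) ^ 2 - ‖x - x₀‖ ^ 2) 0 with h0 | h0
  · exact (mul_nonpos_of_nonneg_of_nonpos hu.pos.le h0).trans (by norm_num)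
  have hin : ∀ w : EuclideanSpace ℝ (Fin 3), ‖w‖ = 1 → inner ℝ (x - x₀) w ≤ ‖x - x₀‖ :=
    fun w hw => by simpa [hw] using real_inner_le_norm (x - x₀) w
  have := squashedForm_le_of_isBounded hu hy1 hy2 hne zero_le_one le_rfl (x₀ := x₀) (t₀ := t₀)
    (x := x) (by linarith [hin y hy1]) (by linarith [hin (-y) hy2]) (by rw [hform]; exact h0) ?_
  · rw [hform] at this; linarith
  · refine hb.subset fun z hz => ?_
    obtain ⟨hz1, hz2, hz3⟩ := hz
    rw [hform, hform] at hz3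
    rw [inner_neg_right] at hz2
    change ‖z - x₀‖ ≤ u z - t₀
    exact le_of_sq_le_sq (by linarith) (by linarith)

/-- The graph of `u` lies above the lightlike hyperplane `t = ⟨x, w⟩ + a`. -/
def LiesAbove (u : EuclideanSpace ℝ (Fin n) → ℝ) (w : EuclideanSpace ℝ (Fin n)) (a : ℝ) : Prop :=
  ∀ z, a + inner ℝ z w ≤ u z

/-- If `y` were the only possible direction, consider the lightlike line of points `(-s y, u 0 - η -
s)`. The null hyperplane with direction `y` through them is the same for all `s` and exceeds `u` at
`y`, so all their shadows are bounded; yet `(η + s)² - s²` is unbounded. -/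
theorem exists_liesAbove_ne (hu : IsAdmissible u c) {y : EuclideanSpace ℝ (Fin 3)}
    (hy : ‖y‖ = 1) : ∃ w, ‖w‖ = 1 ∧ w ≠ y ∧ ∃ a, LiesAbove u w a := by
  by_contra! hcon
  have hlt : u y - u 0 < 1 := by
    have := hu.spacelike.sub_lt (x := y) (z := 0) (by rintro rfl; simp at hy)
    simpa [hy] using this
  set η := (u 0 - u y + 1) / 2 with hη
  have hηpos : 0 < η := by rw [hη]; linarith
  have hb : ∀ s : ℝ, 0 ≤ s → c * ((η + s) ^ 2 - s ^ 2) ≤ 6 := by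
    intro s hs
    have hbd : Bornology.IsBounded (futureShadow u (-(s • y)) (u 0 - η - s)) := by
      by_contra hnb
      obtain ⟨w, hw, hsup⟩ := exists_support_of_not_isBounded hu.spacelike hnb
      have hwy : w = y := by
        by_contra hne
        refine hcon w hw hne (u 0 - η - s + inner ℝ (s • y) w) fun z => ?_
        have := hsup z
        rw [sub_neg_eq_add, inner_add_left] at this
        linarith
      subst hwy
      have := hsup w
      rw [sub_neg_eq_add, inner_add_left, inner_smul_left, real_inner_self_eq_norm_sq, hw] at this
      simp at this
      linarith
    have hns : ‖(0 : EuclideanSpace ℝ (Fin 3)) - -(s • y)‖ = s := by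
      rw [sub_neg_eq_add, zero_add, norm_smul, hy, mul_one, Real.norm_of_nonneg hs]
    have := lorentz_le_of_isBounded hu hbd (x := 0) (by rw [hns]; linarith)
    rw [hns] at this
    have e : u 0 - (u 0 - η - s) = η + s := by ring
    rwa [e] at this
  have hcη : 0 < c * η := mul_pos hu.pos hηpos
  have := hb (6 / (c * η)) (by positivity)
  have e : c * ((η + 6 / (c * η)) ^ 2 - (6 / (c * η)) ^ 2) = c * η * η + 12 := by
    have := hu.pos.ne'
    field_simp; ring
  rw [e] at this
  nlinarith

/-- The graph does not lie below a lightlike hyperplane. -/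
theorem not_lies_below (hu : IsAdmissible u c) {y : EuclideanSpace ℝ (Fin 3)} (hy : ‖y‖ = 1)
    (a : ℝ) : ¬ ∀ z, u z ≤ a + inner ℝ z y := by
  intro h
  obtain ⟨w, -, hne, b, hb⟩ := exists_liesAbove_ne hu hy
  have hle : ∀ s : ℝ, s * ‖w - y‖ ^ 2 ≤ a - b := by
    intro s
    have := (hb (s • (w - y))).trans (h (s • (w - y)))
    rw [← real_inner_self_eq_norm_sq]
    rw [inner_smul_left, inner_smul_left] at this
    rw [inner_sub_right]
    simp only [conj_trivial] at this
    linarith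
  have hpos : 0 < ‖w - y‖ ^ 2 := by
    have := norm_pos_iff.2 (sub_ne_zero.2 hne); positivity
  have := hle ((a - b + 1) / ‖w - y‖ ^ 2)
  rw [div_mul_cancel₀ _ hpos.ne'] at this
  linarith

/-- The best constant in `LiesAbove`. -/
theorem LiesAbove.exists_isGreatest {w : EuclideanSpace ℝ (Fin n)}
    {u : EuclideanSpace ℝ (Fin n) → ℝ} {a : ℝ} (h : LiesAbove u w a) :
    ∃ b, IsGreatest {a | LiesAbove u w a} b := by
  refine ⟨⨅ z, (u z - inner ℝ z w), fun z => ?_, fun b hb => ?_⟩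
  · have hbdd : BddBelow (Set.range fun z => u z - inner ℝ z w) :=
      ⟨a, by rintro _ ⟨z, rfl⟩; simp only; linarith [h z]⟩
    have := ciInf_le hbdd z
    linarith
  · exact le_ciInf fun z => by linarith [hb z]

/-- From `z` to `z + w` the hyperplane rises by `1` and `u` by less, so contact at `z` would be a
crossing at `z + w`. -/
theorem LiesAbove.lt {u : EuclideanSpace ℝ (Fin n) → ℝ} (hu : IsSpacelikeFunction u)
    {w : EuclideanSpace ℝ (Fin n)} (hw : ‖w‖ = 1) {a : ℝ} (h : LiesAbove u w a)
    (z : EuclideanSpace ℝ (Fin n)) : a + inner ℝ z w < u z := by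
  have h1 := hu.sub_lt (x := z + w) (z := z) (by
    intro h0
    rw [add_eq_left] at h0
    simp [h0] at hw)
  have h2 := h (z + w)
  rw [inner_add_left, real_inner_self_eq_norm_sq, hw] at h2
  rw [add_sub_cancel_left, hw] at h1
  linarith

/-- If the lightlike hyperplanes below the graph have at most two directions, then the product of
the heights of the graph over the extremal hyperplanes is bounded. -/
theorem height_mul_height_le (hu : IsAdmissible u c) {y₁ y₂ : EuclideanSpace ℝ (Fin 3)}
    (h₁ : ‖y₁‖ = 1) (h₂ : ‖y₂‖ = 1) (h : y₁ ≠ y₂) {a₁ a₂ : ℝ}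
    (ha₁ : IsGreatest {a | LiesAbove u y₁ a} a₁) (ha₂ : IsGreatest {a | LiesAbove u y₂ a} a₂)
    (hall : ∀ w a, ‖w‖ = 1 → LiesAbove u w a → w = y₁ ∨ w = y₂) (x : EuclideanSpace ℝ (Fin 3)) :
    c * ((u x - a₁ - inner ℝ x y₁) * (u x - a₂ - inner ℝ x y₂)) ≤ 24 * nullGap y₁ y₂ := by
  have hκ := nullGap_pos h₁ h₂ h
  set κ := nullGap y₁ y₂ with hκd
  have hc12 : inner ℝ y₁ y₂ = 1 - 2 * κ := by rw [hκd, nullGap]; ring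
  have hα : 0 < u x - a₁ - inner ℝ x y₁ := by linarith [LiesAbove.lt hu.spacelike h₁ ha₁.1 x]
  have hβ : 0 < u x - a₂ - inner ℝ x y₂ := by linarith [LiesAbove.lt hu.spacelike h₂ ha₂.1 x]
  set α := u x - a₁ - inner ℝ x y₁ with hαd
  set β := u x - a₂ - inner ℝ x y₂ with hβd
  -- The point `(x - v, u x - S)` lies on both extremal hyperplanes, and `(v, S)` is in the span of
  -- the two null vectors, with `S² - |v|² = α β / κ`.
  set v := (2 * κ)⁻¹ • (β • y₁ + α • y₂) with hv
  set S := (α + β) / (2 * κ) with hS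
  have h11 : inner ℝ y₁ y₁ = (1 : ℝ) := by rw [real_inner_self_eq_norm_sq, h₁]; norm_num
  have h22 : inner ℝ y₂ y₂ = (1 : ℝ) := by rw [real_inner_self_eq_norm_sq, h₂]; norm_num
  have hv1 : inner ℝ v y₁ = S - α := by
    rw [hv, inner_smul_left, inner_add_left, inner_smul_left, inner_smul_left, h11,
      real_inner_comm, hc12, hS]
    simp only [conj_trivial]
    field_simp; ring
  have hv2 : inner ℝ v y₂ = S - β := by
    rw [hv, inner_smul_left, inner_add_left, inner_smul_left, inner_smul_left, h22, hc12, hS]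
    simp only [conj_trivial]
    field_simp; ring
  have hR : ‖v‖ ^ 2 = S ^ 2 - α * β / κ := by
    have : ‖v‖ ^ 2 = inner ℝ v v := (real_inner_self_eq_norm_sq v).symm
    rw [this]
    conv_lhs => rw [hv]
    rw [inner_smul_left, inner_add_left, inner_smul_left, inner_smul_left, real_inner_comm,
      hv1, real_inner_comm v, hv2, hS]
    simp only [conj_trivial]
    field_simp; ring
  set R := ‖v‖
  have hR0 : 0 ≤ R := norm_nonneg v
  have hS0 : 0 < S := by positivity
  have hRS : R < S := by
    refine lt_of_pow_lt_pow_left₀ 2 hS0.le ?_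
    have : 0 < α * β / κ := by positivity
    linarith
  -- Raising the point by `δ` puts it strictly above both extremal hyperplanes, hence on no
  -- supporting one, while `(x, u x)` stays in its future.
  set δ := (S - R) / 2 with hδ
  have hbd : Bornology.IsBounded (futureShadow u (x - v) (u x - S + δ)) := by
    by_contra hnb
    obtain ⟨w, hw, hsup⟩ := exists_support_of_not_isBounded hu.spacelike hnb
    have hab : LiesAbove u w (u x - S + δ - inner ℝ x w + inner ℝ v w) := fun z => by
      have := hsup z
      rw [inner_sub_left, inner_sub_left] at this
      linarith
    rcases hall w _ hw hab with rfl | rfl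
    · have := ha₁.2 hab
      linarith
    · have := ha₂.2 hab
      linarith
  have hxv : x - (x - v) = v := by abel
  have hfin := lorentz_le_of_isBounded hu hbd (x := x) (by
    rw [hxv]; change R ≤ _; linarith)
  rw [hxv] at hfin
  change c * (_ - R ^ 2) ≤ 6 at hfin
  have e1 : u x - (u x - S + δ) = (S + R) / 2 := by rw [hδ]; ring
  rw [e1] at hfin
  have e2 : α * β / (4 * κ) ≤ ((S + R) / 2) ^ 2 - R ^ 2 := by
    have : α * β / (4 * κ) = (S ^ 2 - R ^ 2) / 4 := by rw [hR]; field_simp; ring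
    rw [this]
    nlinarith
  have e3 := (mul_le_mul_of_nonneg_left e2 hu.pos.le).trans hfin
  rw [← mul_div_assoc, div_le_iff₀ (by positivity)] at e3
  linarith

/-- Positivity of `Φ` controls the transverse part by `α β / (κ² ε)`, and the two heights control
the rest. The bound blows up as `ε → 0`, hence the need for squashed barriers. -/
theorem norm_le_of_squashedForm_pos {E : Type*} [NormedAddCommGroup E] [InnerProductSpace ℝ E]
    {y₁ y₂ : E} (h₁ : ‖y₁‖ = 1) (h₂ : ‖y₂‖ = 1) (h : y₁ ≠ y₂) {ε L : ℝ} (hε : 0 < ε) {ξ : E}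
    {τ : ℝ} (hα : 0 ≤ τ - inner ℝ ξ y₁) (hβ : 0 ≤ τ - inner ℝ ξ y₂)
    (hαL : τ - inner ℝ ξ y₁ ≤ L) (hβL : τ - inner ℝ ξ y₂ ≤ L)
    (hΦ : 0 < squashedForm y₁ y₂ ε ξ τ) :
    ‖ξ‖ ≤ Real.sqrt (L ^ 2 / (nullGap y₁ y₂ ^ 2 * ε)) + (2 * nullGap y₁ y₂)⁻¹ * (L + L) := by
  have hκ := nullGap_pos h₁ h₂ h
  obtain ⟨hb1, -⟩ := transverse_bounds h₁ h₂ h ξ τ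
  have htr : ξ = transverse y₁ y₂ ξ τ + (2 * nullGap y₁ y₂)⁻¹ •
      ((τ - inner ℝ ξ y₂) • y₁ + (τ - inner ℝ ξ y₁) • y₂) := by
    rw [transverse]; abel
  have hT : ‖transverse y₁ y₂ ξ τ‖ ≤ Real.sqrt (L ^ 2 / (nullGap y₁ y₂ ^ 2 * ε)) := by
    refine Real.le_sqrt_of_sq_le ?_
    have e2 : (τ - inner ℝ ξ y₁) * (τ - inner ℝ ξ y₂) ≤ L ^ 2 := by
      rw [sq]; exact mul_le_mul hαL hβL hβ (hα.trans hαL)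
    rw [squashedForm] at hΦ
    set P := (τ - inner ℝ ξ y₁) * (τ - inner ℝ ξ y₂)
    have e1 : ε * (nullGap y₁ y₂ * ‖transverse y₁ y₂ ξ τ‖ ^ 2) ≤ P / nullGap y₁ y₂ := by
      have : (1 - ε) / nullGap y₁ y₂ * P
          = P / nullGap y₁ y₂ - ε * (P / nullGap y₁ y₂) := by ring
      nlinarith [mul_le_mul_of_nonneg_left hb1 hε.le]
    rw [le_div_iff₀ (by positivity)]
    rw [le_div_iff₀ hκ] at e1
    linarith
  have hN : ‖(2 * nullGap y₁ y₂)⁻¹ • ((τ - inner ℝ ξ y₂) • y₁ + (τ - inner ℝ ξ y₁) • y₂)‖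
      ≤ (2 * nullGap y₁ y₂)⁻¹ * (L + L) := by
    rw [norm_smul, Real.norm_of_nonneg (by positivity)]
    refine mul_le_mul_of_nonneg_left ((norm_add_le _ _).trans ?_) (by positivity)
    rw [norm_smul, norm_smul, h₁, h₂, mul_one, mul_one, Real.norm_of_nonneg hα,
      Real.norm_of_nonneg hβ]
    linarith
  calc ‖ξ‖ ≤ _ := (congrArg norm htr).le.trans (norm_add_le _ _)
    _ ≤ _ := add_le_add hT hN

theorem le_div_of_mul_le {c δ a b M : ℝ} (hc : 0 < c) (hδ : 0 < δ) (ha : 0 ≤ a) (hb : δ ≤ b)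
    (hM : c * (a * b) ≤ M) : a - δ ≤ M / (c * δ) := by
  rw [le_div_iff₀ (by positivity)]
  have h1 : c * (a * δ) ≤ c * (a * b) := by gcongr
  have h2 : 0 < δ * (c * δ) := by positivity
  linarith

/-- With only two directions, `α β` is bounded on the graph. Seen from a vertex raised by `δ`, both
heights exceed `δ` and so are bounded, which bounds the superlevel sets of `Φ_ε`. Then `c Φ_ε ≤ 6 ε`
at a fixed point forces `α β ≤ 0` in the limit. -/
theorem exists_liesAbove_ne_ne (hu : IsAdmissible u c) {y₁ y₂ : EuclideanSpace ℝ (Fin 3)}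
    (h₁ : ‖y₁‖ = 1) (h₂ : ‖y₂‖ = 1) (h : y₁ ≠ y₂) :
    ∃ w, ‖w‖ = 1 ∧ w ≠ y₁ ∧ w ≠ y₂ ∧ ∃ a, LiesAbove u w a := by
  by_contra! hcon
  have hall : ∀ w a, ‖w‖ = 1 → LiesAbove u w a → w = y₁ ∨ w = y₂ := by
    intro w a hw ha
    by_contra! hne
    exact hcon w hw hne.1 hne.2 a ha
  have hex : ∀ {y y' : EuclideanSpace ℝ (Fin 3)}, ‖y'‖ = 1 →
      (∀ w a, ‖w‖ = 1 → LiesAbove u w a → w = y ∨ w = y') →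
      ∃ b, IsGreatest {a | LiesAbove u y a} b := by
    intro y y' hy' hh
    obtain ⟨w, hw, hne, a, ha⟩ := exists_liesAbove_ne hu hy'
    obtain rfl := (hh w a hw ha).resolve_right hne
    exact ha.exists_isGreatest
  obtain ⟨a₁, ha₁⟩ := hex h₂ hall
  obtain ⟨a₂, ha₂⟩ := hex h₁ fun w a hw ha => (hall w a hw ha).symm
  have hκ := nullGap_pos h₁ h₂ h
  have hbound := height_mul_height_le hu h₁ h₂ h ha₁ ha₂ hall
  set κ := nullGap y₁ y₂ with hκd
  have hc12 : inner ℝ y₁ y₂ = 1 - 2 * κ := by rw [hκd, nullGap]; ring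
  have h11 : inner ℝ y₁ y₁ = (1 : ℝ) := by rw [real_inner_self_eq_norm_sq, h₁]; norm_num
  have h22 : inner ℝ y₂ y₂ = (1 : ℝ) := by rw [real_inner_self_eq_norm_sq, h₂]; norm_num
  -- A point on the edge of the wedge; the factor comes from `⟨y₁ - y₂, y₁⟩ = 2 κ = -⟨y₁ - y₂, y₂⟩`.
  obtain ⟨x₀, t₀, ht1, ht2⟩ : ∃ (x₀ : EuclideanSpace ℝ (Fin 3)) (t₀ : ℝ),
      t₀ = a₁ + inner ℝ x₀ y₁ ∧ t₀ = a₂ + inner ℝ x₀ y₂ := by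
    refine ⟨((a₂ - a₁) / (4 * κ)) • (y₁ - y₂), _, rfl, ?_⟩
    rw [inner_smul_left, inner_smul_left, inner_sub_left, inner_sub_left, h11, h22,
      real_inner_comm, hc12]
    simp only [conj_trivial]
    field_simp; ring
  have hpos1 := LiesAbove.lt hu.spacelike h₁ ha₁.1
  have hpos2 := LiesAbove.lt hu.spacelike h₂ ha₂.1
  have hh1 : ∀ δ z, u z - (t₀ + δ) - inner ℝ (z - x₀) y₁ = u z - a₁ - inner ℝ z y₁ - δ := by
    intro δ z; rw [ht1, inner_sub_left]; ring
  have hh2 : ∀ δ z, u z - (t₀ + δ) - inner ℝ (z - x₀) y₂ = u z - a₂ - inner ℝ z y₂ - δ := by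
    intro δ z; rw [ht2, inner_sub_left]; ring
  have hcomp : ∀ δ : ℝ, 0 < δ → ∀ ε : ℝ, 0 < ε → ε ≤ 1 → ∀ x, δ ≤ u x - a₁ - inner ℝ x y₁ →
      δ ≤ u x - a₂ - inner ℝ x y₂ →
      c * squashedForm y₁ y₂ ε (x - x₀) (u x - (t₀ + δ)) ≤ 6 * ε := by
    intro δ hδ ε hε hε1 x hx1 hx2
    rcases le_or_gt (squashedForm y₁ y₂ ε (x - x₀) (u x - (t₀ + δ))) 0 with h0 | h0
    · exact (mul_nonpos_of_nonneg_of_nonpos hu.pos.le h0).trans (by positivity)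
    refine squashedForm_le_of_isBounded hu h₁ h₂ h hε.le hε1 (by rw [hh1]; linarith)
      (by rw [hh2]; linarith) h0 ?_
    set L := 24 * κ / (c * δ) with hL
    have hc := hu.pos
    have hL0 : 0 ≤ L := by positivity
    refine (Metric.isBounded_closedBall (x := x₀)
      (r := Real.sqrt (L ^ 2 / (κ ^ 2 * ε)) + (2 * κ)⁻¹ * (L + L))).subset fun z hz => ?_
    obtain ⟨hz1, hz2, hz3⟩ := hz
    have hbz := hbound z
    rw [mem_closedBall_iff_norm]
    refine norm_le_of_squashedForm_pos h₁ h₂ h hε hz1 hz2 ?_ ?_ (h0.trans_le hz3)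
    · rw [hh1] at hz1 ⊢
      rw [hh2] at hz2
      exact le_div_of_mul_le hc hδ (by linarith) (by linarith) hbz
    · rw [hh1] at hz1
      rw [hh2] at hz2 ⊢
      rw [mul_comm (u z - a₁ - inner ℝ z y₁)] at hbz
      exact le_div_of_mul_le hc hδ (by linarith) (by linarith) hbz
  have hα0 : 0 < u 0 - a₁ - inner ℝ 0 y₁ := by linarith [hpos1 0]
  have hβ0 : 0 < u 0 - a₂ - inner ℝ 0 y₂ := by linarith [hpos2 0]
  obtain ⟨δ, hδ, hδ1, hδ2⟩ : ∃ δ, 0 < δ ∧ δ < u 0 - a₁ - inner ℝ 0 y₁ ∧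
      δ < u 0 - a₂ - inner ℝ 0 y₂ := by
    obtain ⟨δ, h1, h2⟩ := exists_between (lt_min hα0 hβ0)
    exact ⟨δ, h1, h2.trans_le (min_le_left _ _), h2.trans_le (min_le_right _ _)⟩
  have hfin := fun ε h1 h2 => hcomp δ hδ ε h1 h2 0 hδ1.le hδ2.le
  simp only [squashedForm, hh1, hh2, ← hκd] at hfin
  set P := (u 0 - a₁ - inner ℝ 0 y₁ - δ) * (u 0 - a₂ - inner ℝ 0 y₂ - δ)
  have hP : 0 < P := mul_pos (by linarith) (by linarith)
  set Z := (u 0 - (t₀ + δ)) ^ 2 - ‖0 - x₀‖ ^ 2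
  set m := c * (P / κ) with hm
  have hm0 : 0 < m := mul_pos hu.pos (div_pos hP hκ)
  set C := |6 + m - c * Z|
  have hC0 : 0 ≤ C := abs_nonneg _
  have hle : ∀ ε : ℝ, 0 < ε → ε ≤ 1 → m ≤ ε * C := by
    intro ε hε hε1
    have h3 := hfin ε hε hε1
    have h4 : c * ((1 - ε) / κ * P + ε * Z) = m - ε * m + ε * (c * Z) := by rw [hm]; ring
    rw [h4] at h3
    have h5 := mul_le_mul_of_nonneg_left (le_abs_self (6 + m - c * Z)) hε.le
    linarith
  -- For this `ε` the bound reads `m (m + C) ≤ m C`, contradicting `m > 0`.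
  have hlast := hle (m / (m + C)) (by positivity) (by rw [div_le_one (by positivity)]; linarith)
  rw [div_mul_eq_mul_div, le_div_iff₀ (by positivity)] at hlast
  nlinarith

end Comparison

/-! ### The sign of the mean curvature -/

theorem IsSpacelikeFunction.neg {u : EuclideanSpace ℝ (Fin n) → ℝ} (hu : IsSpacelikeFunction u) :
    IsSpacelikeFunction (fun x => - u x) :=
  ⟨hu.smooth.neg, fun x => by rw [fderiv_fun_neg, norm_neg]; exact hu.norm_fderiv_lt_one x⟩

theorem grad_neg (u : EuclideanSpace ℝ (Fin n) → ℝ) (x) :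
    grad (fun x => - u x) x = - grad u x := by
  ext i
  simp [grad, partialDeriv_neg]

theorem hess_neg (u : EuclideanSpace ℝ (Fin n) → ℝ) (x) :
    hess (fun x => - u x) x = - hess u x := by
  ext i j
  have : partialDeriv j (fun x => - u x) = fun x => - partialDeriv j u x :=
    funext fun _ => partialDeriv_neg j
  simp [hess, this, partialDeriv_neg]

theorem metricInv_neg (p : Fin n → ℝ) : metricInv (-p) = metricInv p := by
  have : vecMulVec (-p) (-p) = vecMulVec p p := by ext i j; simp [vecMulVec_apply]
  simp [metricInv, this]

theorem continuous_trace_metricInv_mul_hess {u : EuclideanSpace ℝ (Fin n) → ℝ}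
    (hu : IsSpacelikeFunction u) :
    Continuous fun x => (metricInv (grad u x) * hess u x).trace := by
  have hg : Continuous (grad u) :=
    continuous_pi fun i => (contDiff_partialDeriv hu.smooth i).continuous
  have hh : Continuous (hess u) := continuous_matrix fun i j =>
    (contDiff_partialDeriv (contDiff_partialDeriv hu.smooth j) i).continuous
  have hD : Continuous fun x => (1 - grad u x ⬝ᵥ grad u x)⁻¹ :=
    (continuous_const.sub (hg.dotProduct hg)).inv₀ fun x => by
      have := grad_dotProduct_lt_one hu x
      exact (sub_pos.2 this).ne'
  have hm : Continuous fun x => metricInv (grad u x) :=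
    continuous_const.add (hD.smul (hg.matrix_vecMulVec hg))
  exact (hm.matrix_mul hh).matrix_trace

/-- Since `tr ((S h)²) ≥ 0`, positivity of `sigma` forces `tr (S h) ≠ 0`; by connectedness its sign
is constant. -/
theorem isAdmissible_or_isAdmissible_neg {u : EuclideanSpace ℝ (Fin 3) → ℝ}
    (hu : IsSpacelikeFunction u) {c : ℝ} (hc : 0 < c) (hS : ∀ x, graphScalarCurvature u x ≤ -c) :
    IsAdmissible u c ∨ IsAdmissible (fun x => - u x) c := by
  have hσ : ∀ x, c * (1 - grad u x ⬝ᵥ grad u x) ≤ sigma (metricInv (grad u x)) (hess u x) := by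
    intro x
    have hD : 0 < 1 - grad u x ⬝ᵥ grad u x := sub_pos.2 (grad_dotProduct_lt_one hu x)
    have h := hS x
    rw [graphScalarCurvature_eq hu] at h
    have h2 : c ≤ sigma (metricInv (grad u x)) (hess u x) / (1 - grad u x ⬝ᵥ grad u x) := by
      rw [div_eq_inv_mul]; linarith
    rwa [le_div_iff₀ hD] at h2
  have hne : ∀ x, (metricInv (grad u x) * hess u x).trace ≠ 0 := by
    intro x h0
    have hD : 0 < 1 - grad u x ⬝ᵥ grad u x := sub_pos.2 (grad_dotProduct_lt_one hu x)
    have h1 := hσ x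
    have h2 := trace_mul_self_nonneg (metricInv_posSemidef (grad_dotProduct_lt_one hu x))
      (hess_isSymm hu.smooth x)
    have h3 := mul_pos hc hD
    rw [sigma, h0] at h1
    linarith
  by_cases hpos : ∀ x, 0 < (metricInv (grad u x) * hess u x).trace
  · exact Or.inl ⟨hu, hc, hpos, hσ⟩
  · right
    push Not at hpos
    obtain ⟨x₀, hx₀⟩ := hpos
    refine ⟨hu.neg, hc, fun x => ?_, fun x => ?_⟩
    · rw [grad_neg, metricInv_neg, hess_neg, mul_neg, trace_neg, neg_pos]
      by_contra! hx
      obtain ⟨z, hz⟩ := mem_range_of_exists_le_of_exists_ge (continuous_trace_metricInv_mul_hess hu)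
        ⟨x₀, hx₀⟩ ⟨x, hx⟩
      exact hne z hz
    · rw [grad_neg, metricInv_neg, hess_neg, neg_dotProduct_neg]
      have : sigma (metricInv (grad u x)) (-hess u x) = sigma (metricInv (grad u x)) (hess u x) := by
        simp [sigma]
      rw [this]
      exact hσ x

/-! ### The domain of dependence -/

/-- The later points of a causal curve staying below the graph project into the shadow. If this were
bounded, `u` would be bounded along the curve while time is not. -/
theorem not_isBounded_futureShadow {u : EuclideanSpace ℝ (Fin n) → ℝ} (hu : IsSpacelikeFunction u)
    {f : ℝ → EuclideanSpace ℝ (Fin n)} {t₀ : ℝ} (hf : ∀ s, ‖f s - f t₀‖ ≤ |s - t₀|)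
    (hlt : ∀ s, s < u (f s)) : ¬ Bornology.IsBounded (futureShadow u (f t₀) t₀) := by
  intro hb
  obtain ⟨R, hR⟩ := hb.subset_closedBall (f t₀)
  set s := max t₀ (u (f t₀) + R) with hs
  have h1 : ‖f s - f t₀‖ ≤ s - t₀ := by
    have := hf s
    rwa [abs_of_nonneg (sub_nonneg.2 (le_max_left _ _))] at this
  have h2 : f s ∈ futureShadow u (f t₀) t₀ := h1.trans (by linarith [hlt s])
  have h3 := mem_closedBall_iff_norm.1 (hR h2)
  have h4 := hu.sub_le (f s) (f t₀)
  have h5 : u (f t₀) + R ≤ s := le_max_right _ _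
  linarith [hlt s]

/-- A point on or below a supporting null hyperplane emits a lightlike line that misses the graph.
Conversely, a causal curve missing the graph stays on one side: below it, the unbounded shadow gives
a supporting hyperplane through `p`; above it, time reversal puts the graph below a null hyperplane,
contrary to `not_lies_below`. -/
theorem mem_domainOfDependence_iff {u : EuclideanSpace ℝ (Fin 3) → ℝ} {c : ℝ}
    (hu : IsAdmissible u c) (p : Space 3) :
    p ∈ domainOfDependence (graph u) ↔
      ∀ w a, ‖w‖ = 1 → LiesAbove u w a → a + inner ℝ p.1 w < p.2 := by
  constructor
  · intro hp w a hw ha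
    by_contra! hle
    have hd : ∀ s, HasDerivAt (fun s : ℝ => p.1 + (s - p.2) • w) w s := fun s => by
      simpa using (((hasDerivAt_id s).sub_const p.2).smul_const w).const_add p.1
    obtain ⟨s, hs⟩ := hp (fun s => p.1 + (s - p.2) • w) (by fun_prop)
      (fun s => by rw [(hd s).deriv, hw]) (by simp)
    obtain ⟨z, hz⟩ := hs
    simp only [graphMap, Prod.mk.injEq] at hz
    obtain ⟨rfl, hz⟩ := hz
    have := LiesAbove.lt hu.spacelike hw ha (p.1 + (s - p.2) • w)
    rw [hz, inner_add_left, inner_smul_left, real_inner_self_eq_norm_sq, hw] at this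
    simp at this
    linarith
  · intro h f hf hf' hfp
    have hlip : ∀ s t, ‖f s - f t‖ ≤ |s - t| := by
      intro s t
      have := Convex.norm_image_sub_le_of_norm_deriv_le (s := Set.univ) (C := 1) (f := f) (x := t)
        (y := s) (fun x _ => (hf.differentiable (by simp)) x) (fun x _ => hf' x) convex_univ
        (Set.mem_univ _) (Set.mem_univ _)
      simpa using this
    by_contra! hno
    have hno' : ∀ s, u (f s) - s ≠ 0 := fun s h0 => hno s ⟨f s, by
      simp only [graphMap, Prod.mk.injEq, true_and]; linarith⟩
    have hcont : Continuous fun s => u (f s) - s := by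
      have := hu.spacelike.continuous
      have := hf.continuous
      fun_prop
    by_cases hpos : ∀ s, s < u (f s)
    · obtain ⟨w, hw, hsup⟩ := exists_support_of_not_isBounded hu.spacelike
        (not_isBounded_futureShadow hu.spacelike (fun s => hlip s p.2) hpos)
      have := h w (p.2 - inner ℝ p.1 w) hw fun z => by
        have := hsup z
        rw [hfp, inner_sub_left] at this
        linarith
      linarith
    · push Not at hpos
      obtain ⟨s₀, hs₀⟩ := hpos
      have hneg : ∀ s, u (f s) < s := by
        intro s
        by_contra! hs
        obtain ⟨z, hz⟩ := mem_range_of_exists_le_of_exists_ge hcont (c := 0)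
          ⟨s₀, by linarith⟩ ⟨s, by linarith⟩
        exact hno' z hz
      obtain ⟨w, hw, hsup⟩ := exists_support_of_not_isBounded hu.spacelike.neg
        (not_isBounded_futureShadow hu.spacelike.neg (f := fun s => f (-s)) (t₀ := -p.2)
          (fun s => (hlip _ _).trans (by rw [← abs_neg]; apply le_of_eq; congr 1; ring))
          (fun s => by linarith [hneg (-s)]))
      refine not_lies_below hu (y := -w) (by rw [norm_neg, hw]) (p.2 + inner ℝ p.1 w) fun z => ?_
      have := hsup z
      rw [neg_neg, hfp, inner_sub_left] at this
      rw [inner_neg_right]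
      linarith

/-! ### The boundary function and its regular domain. -/

open Classical in
/-- The function `y ↦ sup_z (⟨z, y⟩ - u z)` on the sphere. -/
def boundaryFunction (u : EuclideanSpace ℝ (Fin n) → ℝ) (y : UnitSphere n) : WithTop ℝ :=
  if h : ∃ b, IsGreatest {a | LiesAbove u y a} b then ((-h.choose : ℝ) : WithTop ℝ) else ⊤

theorem boundaryFunction_le_iff {u : EuclideanSpace ℝ (Fin n) → ℝ} {y : UnitSphere n} {r : ℝ} :
    boundaryFunction u y ≤ r ↔ LiesAbove u y (-r) := by
  constructor
  · intro h
    unfold boundaryFunction at h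
    split_ifs at h with hex
    · rw [WithTop.coe_le_coe] at h
      intro z
      have := hex.choose_spec.1 z
      linarith
    · exact absurd h (by simp)
  · intro h
    have hex := h.exists_isGreatest
    rw [boundaryFunction, dif_pos hex, WithTop.coe_le_coe]
    have := hex.choose_spec.2 h
    linarith

theorem mem_finiteSet {φ : UnitSphere n → WithTop ℝ} {y : UnitSphere n} :
    y ∈ finiteSet φ ↔ φ y < ⊤ := Iff.rfl

theorem mem_finiteSet_boundaryFunction {u : EuclideanSpace ℝ (Fin n) → ℝ} {y : UnitSphere n} :
    y ∈ finiteSet (boundaryFunction u) ↔ ∃ a, LiesAbove u y a := by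
  constructor
  · intro h
    obtain ⟨r, hr⟩ := WithTop.ne_top_iff_exists.1 (mem_finiteSet.1 h).ne
    exact ⟨-r, boundaryFunction_le_iff.1 hr.ge⟩
  · rintro ⟨a, ha⟩
    rw [← neg_neg a] at ha
    exact (boundaryFunction_le_iff.2 ha).trans_lt (WithTop.coe_lt_top _)

/-- Failure of `LiesAbove` is witnessed at a single `z`, which is an open condition on `y`. -/
theorem lowerSemicontinuous_boundaryFunction (u : EuclideanSpace ℝ (Fin n) → ℝ) :
    LowerSemicontinuous (boundaryFunction u) := by
  intro y b hb
  obtain ⟨r, rfl⟩ := WithTop.ne_top_iff_exists.1 (ne_top_of_lt hb)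
  have hb' : ¬ LiesAbove u y (-r) := fun h => absurd (boundaryFunction_le_iff.2 h) (not_le.2 hb)
  simp only [LiesAbove, not_forall, not_le] at hb'
  obtain ⟨z, hz⟩ := hb'
  have hc : Continuous fun y : UnitSphere n => -r + inner ℝ z (y : EuclideanSpace ℝ (Fin n)) := by
    fun_prop
  filter_upwards [hc.continuousAt.eventually (lt_mem_nhds hz)] with y' hy'
  rw [gt_iff_lt, ← not_le, boundaryFunction_le_iff]
  exact fun h => absurd (h z) (not_le.2 hy')

/-- The strict inequality survives the supremum because the sphere is compact and `LiesAbove` is a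
closed condition: almost-optimal directions converge to one whose hyperplane passes through `p`. -/
theorem mem_regularDomain_boundaryFunction_iff {u : EuclideanSpace ℝ (Fin n) → ℝ} (p : Space n) :
    p ∈ regularDomain (boundaryFunction u) ↔
      ∀ w a, ‖w‖ = 1 → LiesAbove u w a → a + inner ℝ p.1 w < p.2 := by
  constructor
  · intro hp w a hw ha
    set y : UnitSphere n := ⟨w, mem_sphere_zero_iff_norm.2 hw⟩
    have hy : y ∈ finiteSet (boundaryFunction u) := mem_finiteSet_boundaryFunction.2 ⟨a, ha⟩
    have h1 := (le_iSup₂ (f := fun y (_ : y ∈ finiteSet (boundaryFunction u)) =>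
      ((inner ℝ p.1 (y : EuclideanSpace ℝ (Fin n)) - (boundaryFunction u y).untopD 0 : ℝ) : EReal))
      y hy).trans_lt hp
    rw [EReal.coe_lt_coe_iff] at h1
    obtain ⟨r, hr⟩ := WithTop.ne_top_iff_exists.1 (mem_finiteSet.1 hy).ne
    rw [← neg_neg a] at ha
    have h2 := boundaryFunction_le_iff.2 (show LiesAbove u y (- -a) from ha)
    rw [← hr, WithTop.coe_le_coe] at h2
    rw [← hr, WithTop.untopD_coe] at h1
    change inner ℝ p.1 w - r < p.2 at h1
    linarith
  · intro h
    by_contra hp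
    simp only [regularDomain, Set.mem_ofPred_eq, not_lt] at hp
    have hex : ∀ N : ℕ, ∃ y : UnitSphere n,
        LiesAbove u y (p.2 - 1 / ((N : ℝ) + 1) - inner ℝ p.1 (y : EuclideanSpace ℝ (Fin n))) := by
      intro N
      have hlt : ((p.2 - 1 / ((N : ℝ) + 1) : ℝ) : EReal) < supportFunction (boundaryFunction u) p.1 :=
        lt_of_lt_of_le (by
          rw [EReal.coe_lt_coe_iff]
          have : 0 < 1 / ((N : ℝ) + 1) := by positivity
          linarith) hp
      simp only [supportFunction, lt_iSup_iff, EReal.coe_lt_coe_iff] at hlt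
      obtain ⟨y, hy, hlt⟩ := hlt
      obtain ⟨r, hr⟩ := WithTop.ne_top_iff_exists.1 (mem_finiteSet.1 hy).ne
      rw [← hr, WithTop.untopD_coe] at hlt
      have hab := boundaryFunction_le_iff.1 hr.ge
      refine ⟨y, fun z => ?_⟩
      have := hab z
      linarith
    choose Y hY using hex
    obtain ⟨y, -, ψ, hψ, hlim⟩ := isCompact_univ.tendsto_subseq fun N => Set.mem_univ (Y N)
    have hyl : LiesAbove u y (p.2 - inner ℝ p.1 (y : EuclideanSpace ℝ (Fin n))) := by
      intro z
      have hlim' := (continuous_subtype_val.tendsto y).comp hlim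
      have h0 : Filter.Tendsto (fun N : ℕ => 1 / ((ψ N : ℝ) + 1)) Filter.atTop (nhds 0) :=
        tendsto_one_div_add_atTop_nhds_zero_nat.comp hψ.tendsto_atTop
      have ht := ((h0.const_sub p.2).sub ((tendsto_const_nhds (x := p.1)).inner hlim')).add
        ((tendsto_const_nhds (x := z)).inner hlim')
      rw [sub_zero] at ht
      exact le_of_tendsto' ht fun N => hY (ψ N) z
    have := h y _ (mem_sphere_zero_iff_norm.1 y.2) hyl
    linarith

theorem domainOfDependence_graph {u : EuclideanSpace ℝ (Fin 3) → ℝ} {c : ℝ}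
    (hu : IsAdmissible u c) :
    domainOfDependence (graph u) = regularDomain (boundaryFunction u) := by
  ext p
  rw [mem_domainOfDependence_iff hu, mem_regularDomain_boundaryFunction_iff]

theorem three_le_encard_finiteSet {u : EuclideanSpace ℝ (Fin 3) → ℝ} {c : ℝ}
    (hu : IsAdmissible u c) : 3 ≤ (finiteSet (boundaryFunction u)).encard := by
  obtain ⟨w₁, h₁, -, a₁, ha₁⟩ := exists_liesAbove_ne hu (y := EuclideanSpace.single 0 1) (by simp)
  obtain ⟨w₂, h₂, h21, a₂, ha₂⟩ := exists_liesAbove_ne hu h₁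
  obtain ⟨w₃, h₃, h31, h32, a₃, ha₃⟩ := exists_liesAbove_ne_ne hu h₁ h₂ h21.symm
  set y₁ : UnitSphere 3 := ⟨w₁, mem_sphere_zero_iff_norm.2 h₁⟩ with hy₁
  set y₂ : UnitSphere 3 := ⟨w₂, mem_sphere_zero_iff_norm.2 h₂⟩ with hy₂
  set y₃ : UnitSphere 3 := ⟨w₃, mem_sphere_zero_iff_norm.2 h₃⟩ with hy₃
  have hcard : ({y₁, y₂, y₃} : Set (UnitSphere 3)).encard = 3 := by
    rw [Set.encard_eq_three]
    refine ⟨y₁, y₂, y₃, ?_, ?_, ?_, rfl⟩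
    · exact fun h => h21 (congrArg Subtype.val h).symm
    · exact fun h => h31 (congrArg Subtype.val h).symm
    · exact fun h => h32 (congrArg Subtype.val h).symm
  rw [← hcard]
  refine Set.encard_le_encard ?_
  rintro y (rfl | rfl | rfl)
  · exact mem_finiteSet_boundaryFunction.2 ⟨a₁, ha₁⟩
  · exact mem_finiteSet_boundaryFunction.2 ⟨a₂, ha₂⟩
  · exact mem_finiteSet_boundaryFunction.2 ⟨a₃, ha₃⟩

/-! ### Wedges -/

theorem timeReversal_timeReversal (p : Space n) : timeReversal (timeReversal p) = p := by
  simp [timeReversal]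

theorem image_timeReversal_image (S : Set (Space n)) :
    timeReversal '' (timeReversal '' S) = S := by
  rw [← Set.image_comp]
  have : (timeReversal ∘ timeReversal : Space n → Space n) = id :=
    funext timeReversal_timeReversal
  rw [this, Set.image_id]

theorem timeReversal_mem_domainOfDependence {S : Set (Space n)} {p : Space n}
    (hp : p ∈ domainOfDependence (timeReversal '' S)) :
    timeReversal p ∈ domainOfDependence S := by
  intro f hf hf' hfp
  obtain ⟨s, q, hq, hqs⟩ := hp (fun s => f (-s)) (hf.comp contDiff_neg)
    (fun s => by rw [deriv_comp_neg, norm_neg]; exact hf' (-s)) hfp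
  refine ⟨-s, ?_⟩
  have : q = (f (-s), -s) := by
    rw [← timeReversal_timeReversal q, hqs]; rfl
  rwa [← this]

theorem domainOfDependence_timeReversal (S : Set (Space n)) :
    domainOfDependence (timeReversal '' S) = timeReversal '' domainOfDependence S := by
  ext p
  constructor
  · exact fun hp => ⟨_, timeReversal_mem_domainOfDependence hp, timeReversal_timeReversal p⟩
  · rintro ⟨q, hq, rfl⟩
    apply timeReversal_mem_domainOfDependence
    rwa [image_timeReversal_image]

theorem image_timeReversal_graph (u : EuclideanSpace ℝ (Fin n) → ℝ) :
    timeReversal '' graph u = graph fun x => - u x := by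
  rw [graph, graph, ← Set.range_comp]
  rfl

/-- On a third supporting hyperplane, the lightlike ray `(s w, a + s)` eventually enters any wedge
with directions other than `w`, yet it never meets the domain. -/
theorem not_isFutureWedge_domainOfDependence {u : EuclideanSpace ℝ (Fin 3) → ℝ} {c : ℝ}
    (hu : IsAdmissible u c) : ¬ IsFutureWedge (domainOfDependence (graph u)) := by
  rintro ⟨y₁, y₂, c₁, c₂, hne, hD⟩
  have h₁ := mem_sphere_zero_iff_norm.1 y₁.2
  have h₂ := mem_sphere_zero_iff_norm.1 y₂.2
  obtain ⟨w, hw, hw1, hw2, a, ha⟩ := exists_liesAbove_ne_ne hu h₁ h₂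
    fun h => hne (Subtype.ext h)
  have i₁ := (inner_lt_one_iff_real_of_norm_eq_one hw h₁).2 hw1
  have i₂ := (inner_lt_one_iff_real_of_norm_eq_one hw h₂).2 hw2
  have hev : ∀ (b i : ℝ), i < 1 → ∀ᶠ s : ℝ in Filter.atTop, s * i - b < a + s := by
    intro b i hi
    filter_upwards [Filter.eventually_gt_atTop ((-b - a) / (1 - i))] with s hs
    rw [div_lt_iff₀ (by linarith)] at hs
    linarith
  obtain ⟨s, hs1, hs2⟩ := ((hev c₁ _ i₁).and (hev c₂ _ i₂)).exists
  have hmem : ((s • w, a + s) : Space 3) ∈ domainOfDependence (graph u) := by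
    rw [hD]
    simp only [futureHalfSpace, Set.mem_inter_iff, Set.mem_ofPred_eq, inner_smul_left]
    exact ⟨hs1, hs2⟩
  have := (mem_domainOfDependence_iff hu _).1 hmem w a hw ha
  simp only [inner_smul_left, real_inner_self_eq_norm_sq, hw] at this
  simp at this

/-- The domain contains all high points of the time axis, and a past wedge does not. -/
theorem not_isFutureWedge_timeReversal_domainOfDependence {u : EuclideanSpace ℝ (Fin 3) → ℝ}
    {c : ℝ} (hu : IsAdmissible u c) :
    ¬ IsFutureWedge (timeReversal '' domainOfDependence (graph u)) := by
  rintro ⟨y₁, y₂, c₁, c₂, -, hD⟩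
  set t := max (u 0 + 1) c₁ with ht
  have hmem : ((0, t) : Space 3) ∈ domainOfDependence (graph u) := by
    rw [mem_domainOfDependence_iff hu]
    intro w a _ ha
    have h1 := ha 0
    have h2 : u 0 + 1 ≤ t := le_max_left _ _
    simp only
    linarith
  have h2 := Set.mem_image_of_mem timeReversal hmem
  rw [hD] at h2
  have h3 := h2.1
  simp only [futureHalfSpace, timeReversal, Set.mem_ofPred_eq, inner_zero_left] at h3
  have h4 : c₁ ≤ t := le_max_right _ _
  linarith

end Minkowski

end

theorem mainTheorem6 (u : EuclideanSpace ℝ (Fin 3) → ℝ) (hu : Minkowski.IsSpacelikeFunction u)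
    (hS : ∃ c : ℝ, 0 < c ∧ ∀ x, Minkowski.graphScalarCurvature u x ≤ -c) :
    (∃ T : Minkowski.Space 3 → Minkowski.Space 3, (T = id ∨ T = Minkowski.timeReversal) ∧
      ∃ φ : Minkowski.UnitSphere 3 → WithTop ℝ, LowerSemicontinuous φ ∧
        3 ≤ (Minkowski.finiteSet φ).encard ∧
        Minkowski.domainOfDependence (T '' Minkowski.graph u) = Minkowski.regularDomain φ) ∧
    ¬ Minkowski.IsWedge (Minkowski.domainOfDependence (Minkowski.graph u)) := by
  obtain ⟨c, hc, hS⟩ := hS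
  rcases Minkowski.isAdmissible_or_isAdmissible_neg hu hc hS with h | h
  · refine ⟨⟨id, Or.inl rfl, Minkowski.boundaryFunction u,
      Minkowski.lowerSemicontinuous_boundaryFunction u, Minkowski.three_le_encard_finiteSet h, ?_⟩,
      ?_⟩
    · rw [Set.image_id, Minkowski.domainOfDependence_graph h]
    · rintro (hw | hw)
      · exact Minkowski.not_isFutureWedge_domainOfDependence h hw
      · exact Minkowski.not_isFutureWedge_timeReversal_domainOfDependence h hw
  · refine ⟨⟨Minkowski.timeReversal, Or.inr rfl, Minkowski.boundaryFunction fun x => - u x,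
      Minkowski.lowerSemicontinuous_boundaryFunction _, Minkowski.three_le_encard_finiteSet h, ?_⟩,
      ?_⟩
    · rw [Minkowski.image_timeReversal_graph, Minkowski.domainOfDependence_graph h]
    · have h1 := Minkowski.not_isFutureWedge_domainOfDependence h
      have h2 := Minkowski.not_isFutureWedge_timeReversal_domainOfDependence h
      rw [← Minkowski.image_timeReversal_graph, Minkowski.domainOfDependence_timeReversal] at h1 h2
      rw [Minkowski.image_timeReversal_image] at h2
      rintro (hw | hw)
      · exact h2 hw
      · exact h1 hw
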